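/- Let $1\le m\le n$. Write $q=(q_0,\dots,q_{n-1})\in\mathbb H^n$ with $q_l=x_{4l}+x_{4l+1}\mathbf i+x_{4l+2}\mathbf j+x_{4l+3}\mathbf k$, so $\mathbb H^n\cong\mathbb R^{4n}$ with Lebesgue measure $dV$. **Forms.** Let $\omega^0,\dots,\omega^{2n-1}$ be a basis of $\mathbb C^{2n}$, $\beta_n=\sum_{l=0}^{n-1}\omega^l\wedge\omega^{n+l}$ and $\Omega_{2n}=\omega^0\wedge\omega^n\wedge\dots\wedge\omega^{n-1}\wedge\omega^{2n-1}$; put $\int_\Omega f\,\Omega_{2n}:=\int_\Omega f\,dV$. For $l=0,\dots,n-1$ let $$\nabla_{l0}=\partial_{x_{4l}}+\mathbf i\,\partial_{x_{4l+1}},\quad \nabla_{l1}=-\partial_{x_{4l+2}}-\mathbf i\,\partial_{x_{4l+3}},\quad \nabla_{(n+l)0}=\partial_{x_{4l+2}}-\mathbf i\,\partial_{x_{4l+3}},\quad \nabla_{(n+l)1}=\partial_{x_{4l}}-\mathbf i\,\partial_{x_{4l+1}}$$ (with $\mathbf i$ the complex imaginary unit), and for a real $C^2$ function $u$ let $\Delta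 u=d_0d_1u=\sum_{A,B}\nabla_{A0}\nabla_{B1}u\;\omega^A\wedge\omega^B$ be the Baston operator. **Quaternionic $m$-subharmonic functions.** For a hyperhermitian quaternionic $n\times n$ matrix $A$ with (real) eigenvalues $\lambda(A)$ let $\mathcal H_m(A)=S_m(\lambda(A))$ be the $m$-th elementary symmetric polynomial of the eigenvalues, and $\Gamma_m=\{A:\mathcal H_m(sI+A)>0\text{ for all }s\ge 0\}$. Let $\frac{\partial}{\partial\bar q_l}=\partial_{x_{4l}}+\mathbf i\partial_{x_{4l+1}}+\mathbf j\partial_{x_{4l+2}}+\mathbf k\partial_{x_{4l+3}}$ and $\frac{\partial}{\partial q_l}=\partial_{x_{4l}}-\mathbf i\partial_{x_{4l+1}}-\mathbf j\partial_{x_{4l+2}}-\mathbf k\partial_{x_{4l+3}}$, acting from the left. A real $C^4$ function $v$ on a domain $\Omega\subseteq\mathbb H^n$ is quaternionic $m$-subharmonic if $\big(\frac{\partial^2v}{\partial\bar q_l\partial q_k}(q)\big)_{l,k}\in\overline{\Gamma}_m$ for every $q\in\Omega$. The class $QSH_m(\Omega)$ consists of the upper semicontinuous functions $u:\Omega\to[-\infty,\infty)$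 in $L^1_{loc}(\Omega)$ such that for all $C^4$ quaternionic $m$-subharmonic functions $v_1,\dots,v_{m-1}$ on $\Omega$ $$\int_\Omega u\,\Delta v_1\wedge\dots\wedge\Delta v_{m-1}\wedge\beta_n^{n-m}\wedge\Delta\varphi\ \ge 0\qquad\text{for all }0\le\varphi\in C_0^\infty(\Omega).$$ **Proposition ($m$-Lelong number).** Let $\Omega\subseteq\mathbb H^n$ be a domain, $R>0$, $B(a,R)\Subset\Omega$ and $u\in QSH_m(\Omega)$. Then the current $\Delta u\wedge\beta_n^{n-1}$, $\varphi\mapsto\int_\Omega u\,\beta_n^{n-1}\wedge\Delta\varphi$, is given by a unique (nonnegative) Radon measure on $\Omega$. For $0<r<R$ denote by $$\sigma(a,r)=\int_{B(a,r)}\Delta u\wedge\beta_n^{n-1}$$ the mass that this measure gives to the ball $B(a,r)$. Then $$\frac{\sigma(a,r)}{r^{4n(m-1)/m}}$$ is a (not necessarily strictly) increasing function of $r\in(0,R)$, and the limit $$v_a(u)=\lim_{r\to0^+}\frac{\sigma(a,r)}{r^{4n(m-1)/m}}$$ exists, is finite and nonnegative. It is called the $m$-Lelong number of $u$ at $a$.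 -/

import Mathlib

open MeasureTheory Filter Topology
open scoped Quaternion ContDiff ComplexOrder

noncomputable section

namespace QuatHessian

/-- The quaternionic space `ℍⁿ` with its Euclidean norm, in real coordinates: the point
`q = (q_0, …, q_{n-1})` with `q_l = x_{4l} + x_{4l+1} i + x_{4l+2} j + x_{4l+3} k` has the
coordinate `x_{4l+a}` at the index `(l, a)`. -/
abbrev HSpace (n : ℕ) : Type := EuclideanSpace ℝ (Fin n × Fin 4)

/-- The real partial derivative `∂_{x_{4l+a}}`, where `j = (l, a)`. -/
def pd {n : ℕ} {F : Type*} [NormedAddCommGroup F] [NormedSpace ℝ F]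
    (j : Fin n × Fin 4) (f : HSpace n → F) (x : HSpace n) : F :=
  fderiv ℝ f x (EuclideanSpace.single j (1 : ℝ))

/-! ### The quaternionic Hessian and the cone `Γ_m` -/

/-- The quaternion units `1, i, j, k`. -/
def unitQ (a : Fin 4) : ℍ[ℝ] :=
  (![⟨1, 0, 0, 0⟩, ⟨0, 1, 0, 0⟩, ⟨0, 0, 1, 0⟩, ⟨0, 0, 0, 1⟩] : Fin 4 → ℍ[ℝ]) a

/-- The Cauchy-Fueter operator
`∂/∂q̄_l = ∂_{x_{4l}} + i ∂_{x_{4l+1}} + j ∂_{x_{4l+2}} + k ∂_{x_{4l+3}}`. -/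
def dqbar {n : ℕ} (l : Fin n) (f : HSpace n → ℍ[ℝ]) (x : HSpace n) : ℍ[ℝ] :=
  ∑ a : Fin 4, unitQ a * pd (l, a) f x

/-- The conjugate operator
`∂/∂q_l = ∂_{x_{4l}} - i ∂_{x_{4l+1}} - j ∂_{x_{4l+2}} - k ∂_{x_{4l+3}}`. -/
def dq {n : ℕ} (l : Fin n) (f : HSpace n → ℍ[ℝ]) (x : HSpace n) : ℍ[ℝ] :=
  ∑ a : Fin 4, star (unitQ a) * pd (l, a) f x

/-- The quaternionic Hessian `(∂²u / ∂q̄_l ∂q_k)_{l,k}` of a real function. -/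
def quatHess {n : ℕ} (u : HSpace n → ℝ) (x : HSpace n) : Matrix (Fin n) (Fin n) ℍ[ℝ] :=
  Matrix.of fun l k => dqbar l (dq k fun y => ((u y : ℝ) : ℍ[ℝ])) x

/-- The family `ev` lists the eigenvalues of the hyperhermitian matrix `A`, with multiplicity:
`U* A U = diag(ev)` for some quaternionic unitary matrix `U`. -/
def IsEigenvalues {n : ℕ} (A : Matrix (Fin n) (Fin n) ℍ[ℝ]) (ev : Fin n → ℝ) : Prop :=
  ∃ U : Matrix (Fin n) (Fin n) ℍ[ℝ],
    U.conjTranspose * U = 1 ∧ U * U.conjTranspose = 1 ∧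
      U.conjTranspose * A * U = Matrix.diagonal fun i => ((ev i : ℝ) : ℍ[ℝ])

/-- The elementary symmetric polynomial `S_m(t)` in `t_0, …, t_{n-1}`. -/
def symmPoly {n : ℕ} (m : ℕ) (t : Fin n → ℝ) : ℝ :=
  ∑ J ∈ Finset.powersetCard m (Finset.univ : Finset (Fin n)), ∏ i ∈ J, t i

/-- The cone `Γ_m` of the hyperhermitian matrices `A` such that `S_m(λ(sI + A)) > 0` for
all `s ≥ 0`. -/
def coneGamma (n m : ℕ) : Set (Matrix (Fin n) (Fin n) ℍ[ℝ]) :=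
  {A | A.IsHermitian ∧ ∃ ev : Fin n → ℝ, IsEigenvalues A ev ∧
    ∀ s : ℝ, 0 ≤ s → 0 < symmPoly m fun i => s + ev i}

/-- A `C^4` quaternionic `m`-subharmonic function on the open set `Ω`: its quaternionic Hessian
lies in the closure of `Γ_m` at every point of `Ω`. -/
def IsSmoothQSH {n : ℕ} (m : ℕ) (Ω : Set (HSpace n)) (v : HSpace n → ℝ) : Prop :=
  ContDiffOn ℝ 4 v Ω ∧ ∀ x ∈ Ω, quatHess v x ∈ closure (coneGamma n m)

/-! ### Forms and the Baston operator -/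

/-- The indices of the basis `ω^0, …, ω^{2n-1}` of `ℂ^{2n}`: `(l, 0)` is the index `l` and
`(l, 1)` is the index `n + l`, for `l = 0, …, n-1`. -/
abbrev FormIdx (n : ℕ) : Type := Fin n × Fin 2

/-- The complex exterior algebra of `ℂ^{2n}`; its product `*` is the wedge product. -/
abbrev Form (n : ℕ) : Type := ExteriorAlgebra ℂ (FormIdx n → ℂ)

/-- The basis element `ω^A`. -/
def omega {n : ℕ} (A : FormIdx n) : Form n :=
  ExteriorAlgebra.ι ℂ (Pi.single A (1 : ℂ) : FormIdx n → ℂ)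

/-- The fundamental form `β_n = ∑_l ω^l ∧ ω^{n+l}`. -/
def beta (n : ℕ) : Form n := ∑ l : Fin n, omega (l, 0) * omega (l, 1)

/-- The form `Ω_{2n} = ω^0 ∧ ω^n ∧ ω^1 ∧ ω^{n+1} ∧ … ∧ ω^{n-1} ∧ ω^{2n-1}`. -/
def volForm (n : ℕ) : Form n :=
  ExteriorAlgebra.ιMulti ℂ (n * 2) fun i =>
    (Pi.single (finProdFinEquiv.symm i) (1 : ℂ) : FormIdx n → ℂ)

/-- The coefficient of `Ω_{2n}` in a form: the determinant in degree `2n`, zero in all other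
degrees. -/
def topCoeff (n : ℕ) : Form n →ₗ[ℂ] ℂ :=
  ExteriorAlgebra.liftAlternating fun i =>
    if h : i = n * 2 then
      (Pi.basisFun ℂ (FormIdx n)).det.domDomCongr (finProdFinEquiv.trans (finCongr h.symm))
    else 0

theorem topCoeff_volForm (n : ℕ) : topCoeff n (volForm n) = 1 := by
  simp only [topCoeff, volForm, ExteriorAlgebra.liftAlternating_apply_ιMulti, dite_true]
  simp only [AlternatingMap.domDomCongr_apply]
  convert (Pi.basisFun ℂ (FormIdx n)).det_self using 2
  funext A
  change (Pi.single (finProdFinEquiv.symm (finProdFinEquiv A)) (1 : ℂ) : FormIdx n → ℂ) = _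
  rw [Equiv.symm_apply_apply, Pi.basisFun_apply]

/-- The operators `∇_{Aα}`: for each `l`, the rows `l` and `n + l` are
`∇_{l0} = ∂_{x_{4l}} + i ∂_{x_{4l+1}}`, `∇_{l1} = - ∂_{x_{4l+2}} - i ∂_{x_{4l+3}}`,
`∇_{(n+l)0} = ∂_{x_{4l+2}} - i ∂_{x_{4l+3}}`, `∇_{(n+l)1} = ∂_{x_{4l}} - i ∂_{x_{4l+1}}`. -/
def nabla {n : ℕ} (A : FormIdx n) (α : Fin 2) (f : HSpace n → ℂ) (x : HSpace n) : ℂ :=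
  (!![pd (A.1, 0) f x + Complex.I * pd (A.1, 1) f x,
      - pd (A.1, 2) f x - Complex.I * pd (A.1, 3) f x;
      pd (A.1, 2) f x - Complex.I * pd (A.1, 3) f x,
      pd (A.1, 0) f x - Complex.I * pd (A.1, 1) f x] : Matrix (Fin 2) (Fin 2) ℂ) A.2 α

/-- The Baston operator `Δu = d_0 d_1 u`, where `d_1 u = ∑_B ∇_{B1} u ω^B` and
`d_0 (∑_B f_B ω^B) = ∑_{A,B} ∇_{A0} f_B ω^A ∧ ω^B`. -/
def baston {n : ℕ} (u : HSpace n → ℝ) (x : HSpace n) : Form n :=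
  ∑ A : FormIdx n, ∑ B : FormIdx n,
    nabla A 0 (nabla B 1 fun y => ((u y : ℝ) : ℂ)) x • (omega A * omega B)

/-! ### Quaternionic `m`-subharmonic functions and the mass of `Δu ∧ β_n^{n-1}` -/

/-- The real test functions on `Ω`. -/
def IsTest {n : ℕ} (Ω : Set (HSpace n)) (φ : HSpace n → ℝ) : Prop :=
  ContDiff ℝ ∞ φ ∧ HasCompactSupport φ ∧ tsupport φ ⊆ Ω

/-- The current `Δu ∧ Δv_1 ∧ … ∧ Δv_k ∧ β_n^p` of top degree (`k + 1 + p = n`), defined by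
`φ ↦ ∫_Ω u Δv_1 ∧ … ∧ Δv_k ∧ β_n^p ∧ Δφ`, where `∫ f Ω_{2n} = ∫ f dV`. -/
def hessianCurrent {n k : ℕ} (Ω : Set (HSpace n)) (u : HSpace n → EReal)
    (v : Fin k → HSpace n → ℝ) (p : ℕ) (φ : HSpace n → ℝ) : ℂ :=
  ∫ x in Ω, (((u x).toReal : ℝ) : ℂ) *
    topCoeff n ((List.ofFn fun j => baston (v j) x).prod * beta n ^ p * baston φ x)

/-- The class `QSH_m(Ω)`: upper semicontinuous `[-∞, ∞)`-valued functions in `L^1_loc(Ω)`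
(in particular finite almost everywhere) such that `Δu ∧ Δv_1 ∧ … ∧ Δv_{m-1} ∧ β_n^{n-m}` is
nonnegative for all `C^4` quaternionic `m`-subharmonic `v_1, …, v_{m-1}` on `Ω`. The order on
`ℂ` is the one for which `0 ≤ z` means that `z` is real and nonnegative. -/
structure IsQSH {n : ℕ} (m : ℕ) (Ω : Set (HSpace n)) (u : HSpace n → EReal) : Prop where
  ne_top : ∀ x ∈ Ω, u x ≠ ⊤
  usc : UpperSemicontinuousOn u Ω
  ae_ne_bot : ∀ᵐ x ∂(volume.restrict Ω), u x ≠ ⊥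
  locInt : LocallyIntegrableOn (fun x => (u x).toReal) Ω volume
  nonneg : ∀ v : Fin (m - 1) → HSpace n → ℝ, (∀ j, IsSmoothQSH m Ω (v j)) →
    ∀ φ : HSpace n → ℝ, IsTest Ω φ → (∀ x, 0 ≤ φ x) →
      0 ≤ hessianCurrent Ω u v (n - m) φ

/-- The Radon measure `μ` on `Ω` (extended by zero to `ℍⁿ`) is the current
`Δu ∧ β_n^{n-1}`. -/
structure IsTraceMeasure {n : ℕ} (Ω : Set (HSpace n)) (u : HSpace n → EReal)
    (μ : Measure (HSpace n)) : Prop where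
  compl_eq_zero : μ Ωᶜ = 0
  finite_on_compacts : ∀ K : Set (HSpace n), IsCompact K → K ⊆ Ω → μ K < ⊤
  integral_eq : ∀ φ : HSpace n → ℝ, IsTest Ω φ →
    ((∫ x, φ x ∂μ : ℝ) : ℂ) = hessianCurrent Ω u (Fin.elim0 : Fin 0 → HSpace n → ℝ) (n - 1) φ

end QuatHessian

end

/-! Everything is tested on functions of `t = ‖x - a‖ ^ 2`. For such a function the Baston operator
is `8 f' β_n + 4 f'' ζ₀ ∧ ζ₁`, and the decomposable form `ζ₀ ∧ ζ₁` commutes with `β_n` and has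
square zero. A product of radial Hessians therefore collapses to a single one: `(Δf)^{m-1} ∧
β_n^{n-m} ∧ Δg = 8^{m-1} β_n^{n-1} ∧ ΔG` as soon as `G' = f'^{m-1} g'` (`hessianCurrent_radial`).

The quaternionic Hessian of `f` has the eigenvalue `8 f'` with multiplicity `n - 1` and the
eigenvalue `8 f' + 4 t f''` once. Hence `f` is `m`-subharmonic when `f' ≥ 0` and `t^{2n/m} f'` is
nondecreasing (`isSmoothQSH_radial`). The extremal choice `f' = t^{-2n/m}`, cut off near `0`, gives
the weight `F = f'^{m-1} = t^{-2n(m-1)/m}`, which is `r^{-4n(m-1)/m}` for `t = r ^ 2`.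

Let `g ≥ 0` be a smoothed indicator of the annulus `t₁ < t < t₂`. Then `G` approximates `F(t₂) 1_{t
< t₂} - F(t₁) 1_{t < t₁}`, and positivity of the current of `u` on `g` says that `∫ G dμ ≥ 0`. This
is the monotonicity up to a smoothing error (`IsQSH.measure_ball_le`), which is removed by a limit.

The measure itself comes from `v_j = ‖x‖ ^ 2`, whose Hessian is `8 β_n`: the trace current is
positive on test functions, and the Riesz extension and representation theorems apply. -/

namespace QuatHessian

/-! ### Derivatives of radial functions -/

section Radial

variable {n : ℕ} {A : Type*} [NormedRing A] [NormedAlgebra ℝ A]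

/-- The linear function `y ↦ ∑_c y_{4l+c} e_c`, the symbol of `∑_c e_c ∂_{x_{4l+c}}`. -/
noncomputable def symb (e : Fin 4 → A) (l : Fin n) : HSpace n →L[ℝ] A :=
  ∑ c : Fin 4, (EuclideanSpace.proj (l, c) : HSpace n →L[ℝ] ℝ).smulRight (e c)

theorem symb_apply (e : Fin 4 → A) (l : Fin n) (y : HSpace n) :
    symb e l y = ∑ c : Fin 4, y (l, c) • e c := by
  simp [symb]

theorem symb_single (e : Fin 4 → A) (l k : Fin n) (c : Fin 4) :
    symb e k (EuclideanSpace.single (l, c) (1 : ℝ)) = if l = k then e c else 0 := by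
  rw [symb_apply]
  by_cases h : l = k
  · subst h
    simp [ite_smul]
  · simp [Ne.symm h, h]

theorem hasFDerivAt_normSq_sub (a x : HSpace n) :
    HasFDerivAt (fun y : HSpace n => ‖y - a‖ ^ 2) (2 • innerSL ℝ (x - a)) x := by
  have h := ((hasFDerivAt_id x).sub_const a).norm_sq
  simpa using h

theorem pd_radial_smul {f : ℝ → ℝ} (hf : Differentiable ℝ f) (a : HSpace n)
    (L : HSpace n →L[ℝ] A) (j : Fin n × Fin 4) (x : HSpace n) :
    pd j (fun y => f (‖y - a‖ ^ 2) • L (y - a)) x =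
      (2 * deriv f (‖x - a‖ ^ 2) * (x - a) j) • L (x - a) +
        f (‖x - a‖ ^ 2) • L (EuclideanSpace.single j 1) := by
  have h1 : HasFDerivAt (fun y : HSpace n => f (‖y - a‖ ^ 2)) _ x :=
    (hf _).hasDerivAt.comp_hasFDerivAt x (hasFDerivAt_normSq_sub a x)
  have h2 : HasFDerivAt (fun y : HSpace n => L (y - a)) _ x :=
    L.hasFDerivAt.comp x ((hasFDerivAt_id x).sub_const a)
  have h3 : HasFDerivAt (fun y : HSpace n => f (‖y - a‖ ^ 2) • L (y - a)) _ x := h1.smul h2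
  rw [pd, h3.fderiv]
  simp [innerSL_apply_apply, EuclideanSpace.inner_single_right]
  rw [add_comm]
  congr 2
  ring

theorem pd_radial_const {f : ℝ → ℝ} (hf : Differentiable ℝ f) (a : HSpace n)
    (c : A) (j : Fin n × Fin 4) (x : HSpace n) :
    pd j (fun y => f (‖y - a‖ ^ 2) • c) x = (2 * deriv f (‖x - a‖ ^ 2) * (x - a) j) • c := by
  have h1 : HasFDerivAt (fun y : HSpace n => f (‖y - a‖ ^ 2)) _ x :=
    (hf _).hasDerivAt.comp_hasFDerivAt x (hasFDerivAt_normSq_sub a x)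
  rw [pd, (h1.smul_const c).fderiv]
  simp [innerSL_apply_apply, EuclideanSpace.inner_single_right]
  congr 1
  ring

/-- The operator `∑_c e_c ∂_{x_{4l+c}}`. -/
noncomputable def dirOp (e : Fin 4 → A) (l : Fin n) (f : HSpace n → A) (x : HSpace n) : A :=
  ∑ c : Fin 4, e c * pd (l, c) f x

theorem dirOp_radial {f : ℝ → ℝ} (hf : Differentiable ℝ f) (a : HSpace n)
    (e : Fin 4 → A) (l : Fin n) (x : HSpace n) :
    dirOp e l (fun y => f (‖y - a‖ ^ 2) • (1 : A)) x =
      (2 * deriv f (‖x - a‖ ^ 2)) • symb e l (x - a) := by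
  simp only [dirOp, pd_radial_const hf, symb_apply, Finset.smul_sum, smul_smul]
  refine Finset.sum_congr rfl fun c _ => ?_
  rw [mul_smul_comm, mul_one]

/-- The inner operator yields `2 f'` times a linear symbol; the outer one differentiates either
`f'`, which produces a second symbol, or the linear symbol itself. The algebra need not be
commutative, so the formula serves both `ℂ` (Baston operator) and `ℍ` (quaternionic Hessian). -/
theorem dirOp_dirOp_radial {f : ℝ → ℝ} (hf : ContDiff ℝ ∞ f) (a : HSpace n)
    (e e' : Fin 4 → A) (l k : Fin n) (x : HSpace n) :
    dirOp e l (dirOp e' k fun y => f (‖y - a‖ ^ 2) • (1 : A)) x =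
      (4 * deriv (deriv f) (‖x - a‖ ^ 2)) • (symb e l (x - a) * symb e' k (x - a)) +
        (2 * deriv f (‖x - a‖ ^ 2)) • (if l = k then ∑ c, e c * e' c else 0) := by
  have hf' : ContDiff ℝ ∞ (deriv f) := (contDiff_infty_iff_deriv.1 hf).2
  have hd : Differentiable ℝ f := hf.differentiable (by simp)
  have hd' : Differentiable ℝ (deriv f) := hf'.differentiable (by simp)
  have h1 : (dirOp e' k fun y => f (‖y - a‖ ^ 2) • (1 : A)) =
      fun y => (fun t => 2 * deriv f t) (‖y - a‖ ^ 2) • symb e' k (y - a) := by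
    funext y
    exact dirOp_radial hd a e' k y
  have h2 : deriv (fun t => 2 * deriv f t) (‖x - a‖ ^ 2) =
      2 * deriv (deriv f) (‖x - a‖ ^ 2) := by
    rw [deriv_const_mul _ (hd' _)]
  rw [h1, dirOp]
  simp only [pd_radial_smul (hd'.const_mul 2), h2, symb_single, mul_add, Finset.sum_add_distrib]
  congr 1
  · rw [symb_apply e l, Finset.sum_mul, Finset.smul_sum]
    refine Finset.sum_congr rfl fun c _ => ?_
    rw [mul_smul_comm, smul_mul_assoc, smul_smul]
    congr 1
    ring
  · split_ifs
    · rw [Finset.smul_sum]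
      exact Finset.sum_congr rfl fun c _ => mul_smul_comm _ _ _
    · simp

end Radial

/-! ### The Baston operator of a radial function -/

/-- The coefficients of `∇_{Aα}`. -/
noncomputable def nablaCoeff (s α : Fin 2) : Fin 4 → ℂ :=
  (!![![1, Complex.I, 0, 0], ![0, 0, -1, -Complex.I];
    ![0, 0, 1, -Complex.I], ![1, -Complex.I, 0, 0]] : Matrix (Fin 2) (Fin 2) (Fin 4 → ℂ)) s α

theorem nabla_eq_dirOp {n : ℕ} (B : FormIdx n) (α : Fin 2) (f : HSpace n → ℂ) (x : HSpace n) :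
    nabla B α f x = dirOp (nablaCoeff B.2 α) B.1 f x := by
  obtain ⟨l, s⟩ := B
  fin_cases s <;> fin_cases α <;>
    simp [nabla, dirOp, nablaCoeff, Fin.sum_univ_four, sub_eq_add_neg]

/-- The form `ζ_0 ∧ ζ_1`, where `ζ_α = ∑_A z_{Aα} ω^A` and `z_{Aα}` is the symbol of
`∇_{Aα}`. -/
noncomputable def radialForm {n : ℕ} (z : HSpace n) : Form n :=
  ExteriorAlgebra.ι ℂ (fun A : FormIdx n => symb (nablaCoeff A.2 0) A.1 z) *
    ExteriorAlgebra.ι ℂ (fun A : FormIdx n => symb (nablaCoeff A.2 1) A.1 z)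

theorem iota_eq_sum {n : ℕ} (v : FormIdx n → ℂ) :
    ExteriorAlgebra.ι ℂ v = ∑ A, v A • omega A := by
  conv_lhs => rw [pi_eq_sum_univ' v]
  simp only [map_sum, map_smul, omega]

/-- In the block `l` the symbols pair to `2` on `ω^l ∧ ω^{n+l}` and to `-2` on the reversed product,
hence to `4` in total; with the factor `2 f'` this is `8 f'`. -/
theorem baston_radial {n : ℕ} {f : ℝ → ℝ} (hf : ContDiff ℝ ∞ f) (a x : HSpace n) :
    baston (fun y => f (‖y - a‖ ^ 2)) x =
      ((8 * deriv f (‖x - a‖ ^ 2) : ℝ) : ℂ) • beta n +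
        ((4 * deriv (deriv f) (‖x - a‖ ^ 2) : ℝ) : ℂ) • radialForm (x - a) := by
  have h0 : (fun y : HSpace n => ((f (‖y - a‖ ^ 2) : ℝ) : ℂ)) =
      fun y => f (‖y - a‖ ^ 2) • (1 : ℂ) := by
    funext y; simp
  have h1 : ∀ A B : FormIdx n,
      nabla A 0 (nabla B 1 fun y => ((f (‖y - a‖ ^ 2) : ℝ) : ℂ)) x =
      (4 * deriv (deriv f) (‖x - a‖ ^ 2)) •
        (symb (nablaCoeff A.2 0) A.1 (x - a) * symb (nablaCoeff B.2 1) B.1 (x - a)) +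
        (2 * deriv f (‖x - a‖ ^ 2)) •
          (if A.1 = B.1 then ∑ c, nablaCoeff A.2 0 c * nablaCoeff B.2 1 c else 0) := by
    intro A B
    rw [h0, nabla_eq_dirOp, ← dirOp_dirOp_radial hf]
    congr 1
    funext y
    exact nabla_eq_dirOp _ _ _ _
  simp only [baston, h1, add_smul, Finset.sum_add_distrib]
  rw [add_comm]
  congr 1
  · rw [beta, Finset.smul_sum, Fintype.sum_prod_type]
    refine Finset.sum_congr rfl fun l _ => ?_
    have h2 : (omega (l, 1) * omega (l, 0) : Form n) = -(omega (l, 0) * omega (l, 1)) :=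
      eq_neg_of_add_eq_zero_left (ExteriorAlgebra.ι_add_mul_swap _ _)
    have h3 : ∀ s : Fin 2, (∑ B : FormIdx n, ((2 * deriv f (‖x - a‖ ^ 2)) •
          (if l = B.1 then ∑ c, nablaCoeff s 0 c * nablaCoeff B.2 1 c else 0) : ℂ) •
            (omega (l, s) * omega B : Form n)) =
        ∑ t : Fin 2, ((2 * deriv f (‖x - a‖ ^ 2)) •
          (∑ c, nablaCoeff s 0 c * nablaCoeff t 1 c) : ℂ) •
            (omega (l, s) * omega (l, t) : Form n) := by
      intro s
      rw [Fintype.sum_prod_type, Finset.sum_eq_single l]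
      · simp
      · intro k _ hk
        simp [Ne.symm hk]
      · simp
    simp only [h3]
    have h4 : ∀ s : Fin 2, (omega (l, s) * omega (l, s) : Form n) = 0 :=
      fun s => ExteriorAlgebra.ι_sq_zero _
    simp only [Fin.sum_univ_two, Fin.sum_univ_four, nablaCoeff, h2, h4, smul_zero, smul_neg]
    simp only [Complex.real_smul]
    simp
    module
  · rw [radialForm, iota_eq_sum, iota_eq_sum, Finset.sum_mul_sum, Finset.smul_sum]
    refine Finset.sum_congr rfl fun A _ => ?_
    rw [Finset.smul_sum]
    refine Finset.sum_congr rfl fun B _ => ?_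
    rw [smul_mul_smul_comm, smul_smul, Complex.real_smul]

/-! ### Wedge products of radial forms -/

theorem commute_iota_mul_iota {n : ℕ} (a b c : FormIdx n → ℂ) :
    Commute (ExteriorAlgebra.ι ℂ a * ExteriorAlgebra.ι ℂ b) (ExteriorAlgebra.ι ℂ c) := by
  have h : ∀ v w : FormIdx n → ℂ, ExteriorAlgebra.ι ℂ v * ExteriorAlgebra.ι ℂ w =
      -(ExteriorAlgebra.ι ℂ w * ExteriorAlgebra.ι ℂ v) :=
    fun v w => eq_neg_of_add_eq_zero_left (ExteriorAlgebra.ι_add_mul_swap _ _)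
  rw [Commute, SemiconjBy, mul_assoc, h b c, mul_neg, ← mul_assoc, h a c, neg_mul, neg_neg,
    mul_assoc]

theorem commute_beta_radialForm {n : ℕ} (z : HSpace n) : Commute (beta n) (radialForm z) := by
  refine Commute.sum_left _ _ _ fun l _ => ?_
  exact (commute_iota_mul_iota _ _ _).mul_right (commute_iota_mul_iota _ _ _)

theorem radialForm_mul_self {n : ℕ} (z : HSpace n) : radialForm z * radialForm z = 0 := by
  rw [radialForm, ← mul_assoc, (commute_iota_mul_iota _ _ _).eq, ← mul_assoc,
    ExteriorAlgebra.ι_sq_zero, zero_mul, zero_mul]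

section Nilpotent

variable {R : Type*} [Ring R] [Algebra ℂ R] {b e : R}

theorem smul_add_smul_pow_succ (hc : Commute b e) (he : e * e = 0) (s r : ℂ) (k : ℕ) :
    (s • b + r • e) ^ (k + 1) = s ^ (k + 1) • b ^ (k + 1) + ((k + 1) * s ^ k * r) • (b ^ k * e) := by
  induction k with
  | zero => simp
  | succ k ih =>
    have h1 : b ^ k * e * b = b ^ (k + 1) * e := by
      rw [mul_assoc, ← hc.eq, ← mul_assoc, pow_succ]
    have h2 : b ^ k * e * e = 0 := by rw [mul_assoc, he, mul_zero]
    rw [pow_succ, ih]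
    simp only [add_mul, mul_add, smul_mul_smul_comm, h1, h2, smul_zero, add_zero, ← pow_succ]
    rw [add_assoc, ← add_smul]
    congr 2
    push_cast
    ring

/-- Since `e * e = 0`, the expansion stops at first order in `e`, and the coefficient of `e` has the
shape of the product rule for `s ^ k * s'`. The truncated exponent `k - 1` is harmless at `k = 0`
because of the factor `k`. -/
theorem smul_add_smul_pow_mul (hc : Commute b e) (he : e * e = 0) (s r s' r' : ℂ) (k p : ℕ) :
    (s • b + r • e) ^ k * b ^ p * (s' • b + r' • e) =
      b ^ (k + p) * ((s ^ k * s') • b + (s ^ k * r' + k * s ^ (k - 1) * r * s') • e) := by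
  cases k with
  | zero => simp
  | succ k =>
    have h1 : b ^ k * e * b ^ p * e = 0 := by
      rw [mul_assoc (b ^ k) e, ← (hc.pow_left p).eq, mul_assoc, mul_assoc, he, mul_zero, mul_zero]
    have h2 : b ^ k * e * b ^ p * b = b ^ (k + 1 + p) * e := by
      rw [mul_assoc (b ^ k * e), ← pow_succ, mul_assoc, ← (hc.pow_left (p + 1)).eq, ← mul_assoc,
        ← pow_add]
      congr 2
      ring
    rw [smul_add_smul_pow_succ hc he]
    simp only [add_mul, mul_add, smul_mul_assoc, mul_smul_comm, h1, h2, ← pow_add, smul_add,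
      smul_smul, smul_zero, add_zero]
    simp only [Nat.add_sub_cancel, Nat.cast_add, Nat.cast_one]
    module

end Nilpotent

/-! ### The quaternionic Hessian of a radial function -/

instance instStarModuleQuaternion : StarModule ℝ ℍ[ℝ] :=
  ⟨fun r q => by simp [Quaternion.star_smul]⟩

theorem coe_eq_smul_one (r : ℝ) : ((r : ℝ) : ℍ[ℝ]) = r • 1 :=
  Algebra.algebraMap_eq_smul_one r

theorem normSq_unitQ (c : Fin 4) : Quaternion.normSq (unitQ c) = 1 := by
  rw [Quaternion.normSq_def']
  fin_cases c <;> simp [unitQ]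

/-- The hyperhermitian matrix `b I + d q q*`. -/
noncomputable def rankOne {n : ℕ} (b d : ℝ) (q : Fin n → ℍ[ℝ]) : Matrix (Fin n) (Fin n) ℍ[ℝ] :=
  Matrix.of fun l k => d • (q l * star (q k)) + if l = k then ((b : ℝ) : ℍ[ℝ]) else 0

theorem quatHess_radial {n : ℕ} {f : ℝ → ℝ} (hf : ContDiff ℝ ∞ f) (a x : HSpace n) :
    quatHess (fun y => f (‖y - a‖ ^ 2)) x =
      rankOne (8 * deriv f (‖x - a‖ ^ 2)) (4 * deriv (deriv f) (‖x - a‖ ^ 2))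
        fun l => symb unitQ l (x - a) := by
  ext1 l k
  have h0 : (fun y : HSpace n => ((f (‖y - a‖ ^ 2) : ℝ) : ℍ[ℝ])) =
      fun y => f (‖y - a‖ ^ 2) • (1 : ℍ[ℝ]) := by
    funext y
    rw [← Algebra.algebraMap_eq_smul_one]
    rfl
  have h1 : star (symb unitQ k (x - a)) = symb (fun c => star (unitQ c)) k (x - a) := by
    simp only [symb_apply, star_sum, star_smul, star_trivial]
  have h2 : ∑ c : Fin 4, unitQ c * star (unitQ c) = ((4 : ℝ) : ℍ[ℝ]) := by
    simp only [Quaternion.self_mul_star, normSq_unitQ, coe_eq_smul_one, Fin.sum_univ_four]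
    module
  have h3 := dirOp_dirOp_radial hf a unitQ (fun c => star (unitQ c)) l k x
  rw [h2, ← h1, ← h0] at h3
  refine h3.trans ?_
  rw [rankOne, Matrix.of_apply]
  congr 1
  split_ifs
  · rw [← Quaternion.coe_smul, smul_eq_mul]
    congr 1
    ring
  · simp

theorem isHermitian_rankOne {n : ℕ} (b d : ℝ) (q : Fin n → ℍ[ℝ]) :
    (rankOne b d q).IsHermitian := by
  ext1 l k
  simp only [rankOne, Matrix.conjTranspose_apply, Matrix.of_apply, star_add, star_smul, star_mul,
    star_star, star_trivial]
  congr 1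
  by_cases h : l = k
  · subst h; simp
  · rw [if_neg h, if_neg (Ne.symm h), star_zero]

/-- A quaternionic unitary matrix that maps `q` into the first coordinate axis. -/
theorem exists_unitary_mul_eq_single {n : ℕ} (i₀ : Fin n) (q : Fin n → ℍ[ℝ]) :
    ∃ (U : Matrix (Fin n) (Fin n) ℍ[ℝ]) (c : ℍ[ℝ]),
      U.conjTranspose * U = 1 ∧ U * U.conjTranspose = 1 ∧
        Quaternion.normSq c = ∑ i, Quaternion.normSq (q i) ∧
        ∀ i, ∑ k, U.conjTranspose i k * q k = if i = i₀ then c else 0 := by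
  set N : ℝ := Real.sqrt (∑ i, Quaternion.normSq (q i)) with hN
  have hS : 0 ≤ ∑ i, Quaternion.normSq (q i) :=
    Finset.sum_nonneg fun i _ => Quaternion.normSq_nonneg
  have hN2 : N * N = ∑ i, Quaternion.normSq (q i) := Real.mul_self_sqrt hS
  rcases hS.eq_or_lt with h0 | hpos
  · refine ⟨1, 0, by simp, by simp, by simpa using h0, fun i => ?_⟩
    have hq : ∀ k, q k = 0 := fun k =>
      Quaternion.normSq_eq_zero.1 ((Finset.sum_eq_zero_iff_of_nonneg
        fun i _ => Quaternion.normSq_nonneg).1 h0.symm k (Finset.mem_univ k))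
    simp [hq]
  have hNpos : 0 < N := Real.sqrt_pos.2 hpos
  -- Householder reflection `1 - s w w*` with `w = q + N e` at `i₀`. Taking for `e` the phase of `q
  -- i₀` (any unit if `q i₀ = 0`) makes `w* q = N² + N r` real, positive and equal to half of `w*
  -- w`. So `s = 2 / |w|²`, and `q` is sent to `q - w`, which is supported at `i₀`.
  obtain ⟨e, he1, r, hr, her⟩ : ∃ e : ℍ[ℝ], Quaternion.normSq e = 1 ∧
      ∃ r : ℝ, 0 ≤ r ∧ q i₀ = r • e := by
    by_cases hq : q i₀ = 0
    · exact ⟨1, by simp, 0, le_rfl, by simp [hq]⟩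
    · have hn : ‖q i₀‖ ≠ 0 := norm_ne_zero_iff.2 hq
      refine ⟨‖q i₀‖⁻¹ • q i₀, ?_, ‖q i₀‖, norm_nonneg _, ?_⟩
      · rw [Quaternion.normSq_smul, Quaternion.normSq_eq_norm_mul_self]
        field_simp
      · rw [smul_smul, mul_inv_cancel₀ hn, one_smul]
  set w : Fin n → ℍ[ℝ] := fun i => q i + if i = i₀ then N • e else 0 with hw
  set s : ℝ := (N * N + N * r)⁻¹ with hs
  have hDpos : 0 < N * N + N * r := by positivity
  have hss : star e * e = 1 := by rw [Quaternion.star_mul_self, he1, Quaternion.coe_one]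
  have hqq : ∑ k, star (q k) * q k = ((N * N : ℝ) : ℍ[ℝ]) := by
    rw [hN2]
    simp only [Quaternion.star_mul_self]
    exact (map_sum (algebraMap ℝ ℍ[ℝ]) _ _).symm
  have hwq : ∑ k, star (w k) * q k = ((N * N + N * r : ℝ) : ℍ[ℝ]) := by
    have h1 : ∀ k, star (w k) * q k =
        star (q k) * q k + if k = i₀ then ((N * r : ℝ) : ℍ[ℝ]) else 0 := by
      intro k
      simp only [hw, star_add, add_mul]
      congr 1
      split_ifs with h
      · rw [h, her, star_smul, star_trivial, smul_mul_smul_comm, hss,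
          ← Algebra.algebraMap_eq_smul_one]
        rfl
      · simp
    rw [Finset.sum_congr rfl fun k _ => h1 k, Finset.sum_add_distrib, hqq]
    simp
  have hww : ∑ k, star (w k) * w k = ((2 * (N * N + N * r) : ℝ) : ℍ[ℝ]) := by
    have h1 : ∀ k, star (w k) * w k =
        star (w k) * q k + if k = i₀ then ((N * r + N * N : ℝ) : ℍ[ℝ]) else 0 := by
      intro k
      conv_lhs => rw [show w k = q k + if k = i₀ then N • e else 0 from rfl]
      rw [show star (q k + if k = i₀ then N • e else 0) = star (w k) from rfl, mul_add]
      congr 1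
      split_ifs with h
      · simp only [hw, h, her, if_true, star_add, star_smul, star_trivial, add_mul,
          smul_mul_smul_comm, hss]
        rw [← add_smul, coe_eq_smul_one, mul_comm r N]
      · simp
    rw [Finset.sum_congr rfl fun k _ => h1 k, Finset.sum_add_distrib, hwq]
    simp only [Finset.sum_ite_eq', Finset.mem_univ, if_true, ← Quaternion.coe_add]
    congr 1
    ring
  set P : Matrix (Fin n) (Fin n) ℍ[ℝ] := Matrix.of fun i k => w i * star (w k) with hP
  have hPH : P.conjTranspose = P := by
    ext1 i k
    simp [hP]
  have hPP : P * P = (2 * (N * N + N * r)) • P := by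
    ext1 i k
    simp only [hP, Matrix.mul_apply, Matrix.of_apply, Matrix.smul_apply]
    calc ∑ j, w i * star (w j) * (w j * star (w k))
        = w i * (∑ j, star (w j) * w j) * star (w k) := by
          simp only [Finset.mul_sum, Finset.sum_mul, mul_assoc]
      _ = _ := by
          rw [hww, ← Quaternion.coe_commutes, mul_assoc, Quaternion.coe_mul_eq_smul]
  have hUH : (1 - s • P).conjTranspose = 1 - s • P := by
    rw [Matrix.conjTranspose_sub, Matrix.conjTranspose_smul, hPH, Matrix.conjTranspose_one,
      star_trivial]
  have hUU : (1 - s • P) * (1 - s • P) = 1 := by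
    rw [sub_mul, mul_sub, mul_sub, one_mul, one_mul, mul_one, smul_mul_smul_comm, hPP, smul_smul,
      show s * s * (2 * (N * N + N * r)) = s + s by rw [hs]; field_simp; ring, add_smul]
    abel
  refine ⟨1 - s • P, -(N • e), by rw [hUH, hUU], by rw [hUH, hUU], ?_, fun i => ?_⟩
  · rw [Quaternion.normSq_neg, Quaternion.normSq_smul, he1, ← hN2]
    ring
  · rw [hUH]
    have h1 : ∑ k, (1 - s • P) i k * q k = q i - w i := by
      simp only [Matrix.sub_apply, sub_mul, Finset.sum_sub_distrib]
      congr 1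
      · simp [Matrix.one_apply]
      · calc ∑ k, (s • P) i k * q k = s • (w i * ∑ k, star (w k) * q k) := by
              simp [hP, Finset.mul_sum, Finset.smul_sum, mul_assoc]
          _ = w i := by
              rw [hwq, Quaternion.mul_coe_eq_smul, smul_smul, hs, inv_mul_cancel₀ hDpos.ne',
                one_smul]
    rw [h1]
    simp only [hw]
    split_ifs <;> simp

theorem isEigenvalues_rankOne {n : ℕ} (i₀ : Fin n) (b d : ℝ) (q : Fin n → ℍ[ℝ]) :
    IsEigenvalues (rankOne b d q)
      fun i => b + if i = i₀ then d * ∑ k, Quaternion.normSq (q k) else 0 := by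
  obtain ⟨U, c, hU1, hU2, hc, hUq⟩ := exists_unitary_mul_eq_single i₀ q
  refine ⟨U, hU1, hU2, ?_⟩
  have h0 : rankOne b d q = d • (Matrix.of fun l k => q l * star (q k)) + b • 1 := by
    ext1 l k
    simp only [rankOne, Matrix.of_apply, Matrix.add_apply, Matrix.smul_apply, Matrix.one_apply]
    congr 1
    split_ifs
    · exact coe_eq_smul_one _
    · simp
  have h1 : U.conjTranspose * (Matrix.of fun l k => q l * star (q k)) * U =
      Matrix.of fun i k => (if i = i₀ then c else 0) * star (if k = i₀ then c else 0) := by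
    ext1 i k
    rw [Matrix.of_apply, ← hUq, ← hUq, Matrix.mul_apply, star_sum, Finset.mul_sum]
    refine Finset.sum_congr rfl fun j _ => ?_
    rw [Matrix.mul_apply, Finset.sum_mul, Finset.sum_mul]
    refine Finset.sum_congr rfl fun l _ => ?_
    simp [mul_assoc]
  rw [h0, mul_add, add_mul, mul_smul_comm, smul_mul_assoc, h1, mul_smul_comm, mul_one,
    smul_mul_assoc, hU1]
  ext1 i k
  simp only [Matrix.add_apply, Matrix.smul_apply, Matrix.of_apply, Matrix.one_apply,
    Matrix.diagonal_apply]
  by_cases hik : i = k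
  · subst hik
    by_cases hi : i = i₀
    · simp only [hi, if_true]
      rw [Quaternion.self_mul_star, hc, coe_eq_smul_one, coe_eq_smul_one, smul_smul, ← add_smul,
        add_comm]
    · simp only [hi, if_true, if_false]
      simp [coe_eq_smul_one]
  · have : (if i = i₀ then c else 0) * star (if k = i₀ then c else 0) = 0 := by
      by_cases hi : i = i₀
      · have hk : k ≠ i₀ := fun h => hik (hi.trans h.symm)
        simp [hk]
      · simp [hi]
    simp [this, hik]

/-- Splitting the index sets by membership of `i₀` gives `C(n-1,m) b^m + C(n-1,m-1) b^{m-1} (b +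
d)`, and `C(n-1,m) + C(n-1,m-1) = (n/m) C(n-1,m-1)`. For `b > 0` the sign is that of `(n/m) b + d`,
which is the source of the exponent `2n/m`. -/
theorem symmPoly_add_single {n : ℕ} (i₀ : Fin n) {m : ℕ} (hm : 1 ≤ m) (hmn : m ≤ n) (b d : ℝ) :
    symmPoly m (fun i : Fin n => b + if i = i₀ then d else 0) =
      ((n - 1).choose (m - 1) : ℝ) * b ^ (m - 1) * (n / m * b + d) := by
  obtain ⟨k, rfl⟩ : ∃ k, m = k + 1 := ⟨m - 1, by omega⟩
  obtain ⟨p, rfl⟩ : ∃ p, n = p + 1 := ⟨n - 1, by omega⟩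
  have hins : (Finset.univ : Finset (Fin (p + 1))) = insert i₀ (Finset.univ.erase i₀) := by simp
  have hnot : i₀ ∉ Finset.univ.erase i₀ := by simp
  have hcard : (Finset.univ.erase i₀).card = p := by simp
  have hprod : ∀ J ⊆ Finset.univ.erase i₀,
      ∏ i ∈ J, (b + if i = i₀ then d else 0) = b ^ J.card := by
    intro J hJ
    rw [Finset.prod_congr rfl (g := fun _ => b), Finset.prod_const]
    intro i hi
    simp [Finset.ne_of_mem_erase (hJ hi)]
  have hdisj : Disjoint (Finset.powersetCard (k + 1) (Finset.univ.erase i₀))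
      ((Finset.powersetCard k (Finset.univ.erase i₀)).image (insert i₀)) := by
    rw [Finset.disjoint_left]
    rintro J hJ hJ'
    obtain ⟨J', -, rfl⟩ := Finset.mem_image.1 hJ'
    exact hnot ((Finset.mem_powersetCard.1 hJ).1 (Finset.mem_insert_self _ _))
  rw [symmPoly, hins, Finset.powersetCard_succ_insert hnot, Finset.sum_union hdisj,
    Finset.sum_image]
  · have h1 : ∑ J ∈ Finset.powersetCard (k + 1) (Finset.univ.erase i₀),
        ∏ i ∈ J, (b + if i = i₀ then d else 0) = (p.choose (k + 1) : ℝ) * b ^ (k + 1) := by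
      rw [Finset.sum_congr rfl (g := fun _ => b ^ (k + 1))]
      · simp [hcard]
      · intro J hJ
        obtain ⟨h, h'⟩ := Finset.mem_powersetCard.1 hJ
        rw [hprod J h, h']
    have h2 : ∑ J ∈ Finset.powersetCard k (Finset.univ.erase i₀),
        ∏ i ∈ insert i₀ J, (b + if i = i₀ then d else 0) =
          (p.choose k : ℝ) * ((b + d) * b ^ k) := by
      rw [Finset.sum_congr rfl (g := fun _ => (b + d) * b ^ k)]
      · simp [hcard]
      · intro J hJ
        obtain ⟨h, h'⟩ := Finset.mem_powersetCard.1 hJ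
        rw [Finset.prod_insert fun hi => hnot (h hi), hprod J h, h', if_pos rfl]
    rw [h1, h2]
    have h3 : ((p + 1 : ℕ) : ℝ) * p.choose k = (p.choose k + p.choose (k + 1)) * (k + 1 : ℕ) := by
      have := Nat.add_one_mul_choose_eq p k
      rw [Nat.choose_succ_succ'] at this
      exact_mod_cast this
    have hk : ((k + 1 : ℕ) : ℝ) ≠ 0 := by positivity
    have h4 : (p.choose (k + 1) : ℝ) = ((p + 1 : ℕ) : ℝ) / (k + 1 : ℕ) * p.choose k -
        p.choose k := by
      rw [div_mul_eq_mul_div, h3]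
      field_simp
      ring
    rw [h4]
    simp only [Nat.add_sub_cancel]
    ring
  · intro J hJ J' hJ' h
    have hn : ∀ J ∈ Finset.powersetCard k (Finset.univ.erase i₀), i₀ ∉ J :=
      fun J hJ hi => hnot ((Finset.mem_powersetCard.1 hJ).1 hi)
    rw [← Finset.erase_insert (hn J hJ), ← Finset.erase_insert (hn J' hJ'), h]

/-- Replacing `b` by `b + ε` preserves the shape of the matrix and makes both weak inequalities
strict, so the perturbed matrices lie in the open condition defining `Γ_m`. -/
theorem rankOne_mem_closure_coneGamma {n m : ℕ} (hm : 1 ≤ m) (hmn : m ≤ n) {b d : ℝ}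
    {q : Fin n → ℍ[ℝ]} (hb : 0 ≤ b) (hbd : 0 ≤ n / m * b + d * ∑ k, Quaternion.normSq (q k)) :
    rankOne b d q ∈ closure (coneGamma n m) := by
  have hcont : Continuous fun ε : ℝ => rankOne (b + ε) d q := by
    refine continuous_matrix fun l k => ?_
    simp only [rankOne, Matrix.of_apply]
    refine continuous_const.add ?_
    split_ifs
    · exact Quaternion.continuous_coe.comp (continuous_const.add continuous_id)
    · exact continuous_const
  have hlim : Tendsto (fun ε : ℝ => rankOne (b + ε) d q) (𝓝[>] 0) (𝓝 (rankOne b d q)) := by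
    have := (hcont.tendsto 0).mono_left (nhdsWithin_le_nhds (s := Set.Ioi (0 : ℝ)))
    simpa using this
  refine mem_closure_of_tendsto hlim ?_
  filter_upwards [self_mem_nhdsWithin] with ε hε
  have hε : 0 < ε := hε
  refine ⟨isHermitian_rankOne _ _ _, _, isEigenvalues_rankOne ⟨0, by omega⟩ _ _ _, fun s hs => ?_⟩
  have hm' : (0 : ℝ) < m := by exact_mod_cast hm
  have hn' : (0 : ℝ) < n := by exact_mod_cast hm.trans hmn
  simp only [← add_assoc]
  rw [symmPoly_add_single _ hm hmn]
  have h1 : 0 < s + b + ε := by positivity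
  have h2 : 0 < (n - 1).choose (m - 1) := Nat.choose_pos (by omega)
  have h3 : 0 < (n : ℝ) / m * (s + ε) := by positivity
  have h4 : 0 < (n : ℝ) / m * (s + b + ε) + d * ∑ k, Quaternion.normSq (q k) := by nlinarith
  positivity

theorem sum_normSq_symb {n : ℕ} (z : HSpace n) :
    ∑ l, Quaternion.normSq (symb unitQ l z) = ‖z‖ ^ 2 := by
  rw [EuclideanSpace.norm_sq_eq, Fintype.sum_prod_type]
  refine Finset.sum_congr rfl fun l _ => ?_
  have h : symb unitQ l z = (⟨z (l, 0), z (l, 1), z (l, 2), z (l, 3)⟩ : ℍ[ℝ]) := by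
    rw [symb_apply, Fin.sum_univ_four]
    change (⟨z (l, 0) * 1 + z (l, 1) * 0 + z (l, 2) * 0 + z (l, 3) * 0,
      z (l, 0) * 0 + z (l, 1) * 1 + z (l, 2) * 0 + z (l, 3) * 0,
      z (l, 0) * 0 + z (l, 1) * 0 + z (l, 2) * 1 + z (l, 3) * 0,
      z (l, 0) * 0 + z (l, 1) * 0 + z (l, 2) * 0 + z (l, 3) * 1⟩ : ℍ[ℝ]) = _
    simp
  rw [Quaternion.normSq_def', h]
  simp [Fin.sum_univ_four]

/-- For `t > 0`, hypothesis `h2` says that `t^{2n/m} f'` has nonnegative derivative; up to the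
factor `4` it is the condition on the rank-one perturbation `8 f' I + 4 f'' q q*`, where `|q|² = t`.
-/
theorem isSmoothQSH_radial {n m : ℕ} (hm : 1 ≤ m) (hmn : m ≤ n) (Ω : Set (HSpace n))
    {f : ℝ → ℝ} (hf : ContDiff ℝ ∞ f) (a : HSpace n) (h1 : ∀ t, 0 ≤ t → 0 ≤ deriv f t)
    (h2 : ∀ t, 0 ≤ t → 0 ≤ 2 * n / m * deriv f t + t * deriv (deriv f) t) :
    IsSmoothQSH m Ω fun y => f (‖y - a‖ ^ 2) := by
  refine ⟨ContDiff.contDiffOn ?_, fun x _ => ?_⟩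
  · have : ContDiff ℝ ∞ fun y : HSpace n => f (‖y - a‖ ^ 2) :=
      hf.comp ((contDiff_id.sub contDiff_const).norm_sq ℝ)
    exact this.of_le (by exact WithTop.coe_le_coe.2 le_top)
  · rw [quatHess_radial hf]
    have ht : 0 ≤ ‖x - a‖ ^ 2 := by positivity
    refine rankOne_mem_closure_coneGamma hm hmn (by linarith [h1 _ ht]) ?_
    rw [sum_normSq_symb]
    have := h2 _ ht
    have e : (n : ℝ) / m * (8 * deriv f (‖x - a‖ ^ 2)) +
        4 * deriv (deriv f) (‖x - a‖ ^ 2) * ‖x - a‖ ^ 2 =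
        4 * (2 * n / m * deriv f (‖x - a‖ ^ 2) +
          ‖x - a‖ ^ 2 * deriv (deriv f) (‖x - a‖ ^ 2)) := by ring
    rw [e]
    linarith

/-! ### Linearity and locality of the Baston operator -/

section DirOp

variable {n : ℕ} {A : Type*} [NormedRing A] [NormedAlgebra ℝ A]

theorem contDiff_dirOp (e : Fin 4 → A) (l : Fin n) {f : HSpace n → A} (hf : ContDiff ℝ ∞ f) :
    ContDiff ℝ ∞ (dirOp e l f) := by
  refine ContDiff.sum fun c _ => contDiff_const.mul ?_
  exact (hf.fderiv_right (m := ∞) (by simp)).clm_apply contDiff_const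

theorem dirOp_smul_add (e : Fin 4 → A) (l : Fin n) {f g : HSpace n → A}
    (hf : ContDiff ℝ ∞ f) (hg : ContDiff ℝ ∞ g) (c : ℝ) :
    dirOp e l (fun y => c • f y + g y) = fun y => c • dirOp e l f y + dirOp e l g y := by
  funext x
  have hf' : DifferentiableAt ℝ f x := (hf.differentiable (by simp)) x
  have hg' : DifferentiableAt ℝ g x := (hg.differentiable (by simp)) x
  have h : fderiv ℝ (fun y => c • f y + g y) x = c • fderiv ℝ f x + fderiv ℝ g x :=
    ((hf'.hasFDerivAt.const_smul c).add hg'.hasFDerivAt).fderiv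
  simp only [dirOp, pd, h, add_apply, smul_apply, mul_add,
    mul_smul_comm, Finset.sum_add_distrib, Finset.smul_sum]

theorem dirOp_eventuallyEq_zero (e : Fin 4 → A) (l : Fin n) {f : HSpace n → A} {x : HSpace n}
    (h : f =ᶠ[𝓝 x] 0) : dirOp e l f =ᶠ[𝓝 x] 0 := by
  filter_upwards [h.eventuallyEq_nhds] with y hy
  have h1 : fderiv ℝ f y = 0 := by
    rw [hy.fderiv_eq]
    exact fderiv_const_apply _
  simp [dirOp, pd, h1]

end DirOp

theorem contDiff_ofReal_comp {n : ℕ} {φ : HSpace n → ℝ} (hφ : ContDiff ℝ ∞ φ) :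
    ContDiff ℝ ∞ fun y => ((φ y : ℝ) : ℂ) :=
  Complex.ofRealCLM.contDiff.comp hφ

theorem nabla_nabla_eq_dirOp {n : ℕ} (A B : FormIdx n) (f : HSpace n → ℂ) :
    nabla A 0 (nabla B 1 f) =
      dirOp (nablaCoeff A.2 0) A.1 (dirOp (nablaCoeff B.2 1) B.1 f) := by
  funext x
  rw [nabla_eq_dirOp]
  congr 1
  funext y
  exact nabla_eq_dirOp _ _ _ _

theorem baston_smul_add {n : ℕ} {φ ψ : HSpace n → ℝ} (hφ : ContDiff ℝ ∞ φ)
    (hψ : ContDiff ℝ ∞ ψ) (c : ℝ) (x : HSpace n) :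
    baston (fun y => c * φ y + ψ y) x = (c : ℂ) • baston φ x + baston ψ x := by
  have h0 : (fun y => ((c * φ y + ψ y : ℝ) : ℂ)) =
      fun y => c • ((φ y : ℝ) : ℂ) + ((ψ y : ℝ) : ℂ) := by
    funext y
    simp
  have hφ' := contDiff_ofReal_comp hφ
  have hψ' := contDiff_ofReal_comp hψ
  simp only [baston, nabla_nabla_eq_dirOp, h0, Finset.smul_sum, ← Finset.sum_add_distrib]
  refine Finset.sum_congr rfl fun A _ => Finset.sum_congr rfl fun B _ => ?_
  rw [dirOp_smul_add _ _ hφ' hψ', dirOp_smul_add _ _ (contDiff_dirOp _ _ hφ')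
    (contDiff_dirOp _ _ hψ'), add_smul, smul_smul, Complex.real_smul]

theorem baston_eq_zero_of_notMem_tsupport {n : ℕ} {φ : HSpace n → ℝ} {x : HSpace n}
    (hx : x ∉ tsupport φ) : baston φ x = 0 := by
  have h : (fun y => ((φ y : ℝ) : ℂ)) =ᶠ[𝓝 x] 0 := by
    filter_upwards [notMem_tsupport_iff_eventuallyEq.1 hx] with y hy
    simp [hy]
  refine Finset.sum_eq_zero fun A _ => Finset.sum_eq_zero fun B _ => ?_
  rw [nabla_nabla_eq_dirOp,
    (dirOp_eventuallyEq_zero _ _ (dirOp_eventuallyEq_zero _ _ h)).eq_of_nhds, Pi.zero_apply,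
    zero_smul]

theorem continuous_topCoeff_mul_baston {n : ℕ} (θ : Form n) {φ : HSpace n → ℝ}
    (hφ : ContDiff ℝ ∞ φ) : Continuous fun x => topCoeff n (θ * baston φ x) := by
  simp only [baston, nabla_nabla_eq_dirOp, Finset.mul_sum, mul_smul_comm, map_sum, map_smul]
  refine continuous_finsetSum _ fun A _ => continuous_finsetSum _ fun B _ => ?_
  exact (contDiff_dirOp _ _ (contDiff_dirOp _ _ (contDiff_ofReal_comp hφ))).continuous.smul
    continuous_const

/-! ### The current `Δu ∧ β_n^{n-1}` -/

section Current

variable {n : ℕ} {Ω : Set (HSpace n)}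

theorem IsTest.smul_add {φ ψ : HSpace n → ℝ} (hφ : IsTest Ω φ) (hψ : IsTest Ω ψ) (c : ℝ) :
    IsTest Ω fun y => c * φ y + ψ y := by
  have hsub : tsupport (fun y => c * φ y + ψ y) ⊆ tsupport φ ∪ tsupport ψ := by
    refine closure_minimal (fun y hy => ?_) ((isClosed_tsupport _).union (isClosed_tsupport _))
    by_contra h
    rw [Set.mem_union, not_or] at h
    exact hy (by simp [image_eq_zero_of_notMem_tsupport h.1,
      image_eq_zero_of_notMem_tsupport h.2])
  exact ⟨(contDiff_const.mul hφ.1).add hψ.1,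
    (hφ.2.1.isCompact.union hψ.2.1.isCompact).of_isClosed_subset (isClosed_tsupport _) hsub,
    hsub.trans (Set.union_subset hφ.2.2 hψ.2.2)⟩

theorem isTest_zero : IsTest Ω (0 : HSpace n → ℝ) :=
  ⟨contDiff_const, HasCompactSupport.zero, by simp [tsupport]⟩

theorem integrableOn_mul_topCoeff (hΩ : IsOpen Ω) {u : HSpace n → ℝ}
    (hu : LocallyIntegrableOn u Ω volume) (θ : Form n) {φ : HSpace n → ℝ} (hφ : IsTest Ω φ) :
    IntegrableOn (fun x => ((u x : ℝ) : ℂ) * topCoeff n (θ * baston φ x)) Ω := by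
  have hK : IsCompact (tsupport φ) := hφ.2.1.isCompact
  have h1 : IntegrableOn u (tsupport φ) := hu.integrableOn_compact_subset hφ.2.2 hK
  have h2 : IntegrableOn (fun x => ((u x : ℝ) : ℂ) * topCoeff n (θ * baston φ x))
      (tsupport φ) :=
    IntegrableOn.mul_continuousOn (Integrable.ofReal h1)
      (continuous_topCoeff_mul_baston θ hφ.1).continuousOn hK
  refine h2.of_forall_sdiff_eq_zero hΩ.measurableSet fun x hx => ?_
  rw [baston_eq_zero_of_notMem_tsupport hx.2, mul_zero, map_zero, mul_zero]

/-- The current `Δu ∧ β_n^{n-1}`. -/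
noncomputable abbrev traceCurrent (Ω : Set (HSpace n)) (u : HSpace n → EReal)
    (φ : HSpace n → ℝ) : ℂ :=
  hessianCurrent Ω u (Fin.elim0 : Fin 0 → HSpace n → ℝ) (n - 1) φ

theorem traceCurrent_eq (u : HSpace n → EReal) (φ : HSpace n → ℝ) :
    traceCurrent Ω u φ =
      ∫ x in Ω, (((u x).toReal : ℝ) : ℂ) * topCoeff n (beta n ^ (n - 1) * baston φ x) := by
  simp [traceCurrent, hessianCurrent]

theorem traceCurrent_smul_add (hΩ : IsOpen Ω) {u : HSpace n → EReal}
    (hu : LocallyIntegrableOn (fun x => (u x).toReal) Ω volume) {φ ψ : HSpace n → ℝ}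
    (hφ : IsTest Ω φ) (hψ : IsTest Ω ψ) (c : ℝ) :
    traceCurrent Ω u (fun y => c * φ y + ψ y) = c * traceCurrent Ω u φ + traceCurrent Ω u ψ := by
  rw [traceCurrent_eq, traceCurrent_eq, traceCurrent_eq, ← integral_const_mul,
    ← integral_add ((integrableOn_mul_topCoeff hΩ hu _ hφ).const_mul _)
      (integrableOn_mul_topCoeff hΩ hu _ hψ)]
  refine integral_congr_ae (Eventually.of_forall fun x => ?_)
  simp only [baston_smul_add hφ.1 hψ.1, mul_add, mul_smul_comm, map_add, map_smul, smul_eq_mul]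
  ring

/-- Both integrands are `β_n^{n-1}` times a combination of `β_n` and `ζ₀ ∧ ζ₁`. The `β_n`
coefficients agree by `G' = f'^{m-1} g'`, and the other ones by differentiating this identity. -/
theorem hessianCurrent_radial (u : HSpace n → EReal) {m : ℕ} (hm : 1 ≤ m) (hmn : m ≤ n)
    {f g G : ℝ → ℝ} (hf : ContDiff ℝ ∞ f) (hg : ContDiff ℝ ∞ g) (hG : ContDiff ℝ ∞ G)
    (hfg : deriv G = fun t => deriv f t ^ (m - 1) * deriv g t) (a : HSpace n) :
    hessianCurrent Ω u (fun (_ : Fin (m - 1)) y => f (‖y - a‖ ^ 2)) (n - m)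
        (fun y => g (‖y - a‖ ^ 2)) =
      8 ^ (m - 1) * traceCurrent Ω u fun y => G (‖y - a‖ ^ 2) := by
  rw [traceCurrent_eq, hessianCurrent, ← integral_const_mul]
  refine integral_congr_ae (Eventually.of_forall fun x => ?_)
  have hd : ∀ {h : ℝ → ℝ}, ContDiff ℝ ∞ h → Differentiable ℝ (deriv h) := fun hh =>
    (contDiff_infty_iff_deriv.1 hh).2.differentiable (by simp)
  have hG2 : ∀ t, deriv (deriv G) t = deriv f t ^ (m - 1) * deriv (deriv g) t +
      (m - 1 : ℕ) * deriv f t ^ (m - 1 - 1) * deriv (deriv f) t * deriv g t := by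
    intro t
    rw [hfg]
    have := ((hd hf t).hasDerivAt.pow (m - 1)).mul (hd hg t).hasDerivAt
    rw [HasDerivAt.deriv (f := fun t => deriv f t ^ (m - 1) * deriv g t) this, add_comm]
    simp
  simp only [baston_radial hf, baston_radial hg, baston_radial hG, List.ofFn_const,
    List.prod_replicate, hG2]
  rw [smul_add_smul_pow_mul (commute_beta_radialForm _) (radialForm_mul_self _), hfg,
    show m - 1 + (n - m) = n - 1 by omega, mul_left_comm, ← smul_eq_mul ((8 : ℂ) ^ (m - 1)),
    ← map_smul, ← mul_smul_comm, smul_add, smul_smul, smul_smul]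
  congr 5
  · push_cast
    ring
  · push_cast
    -- For `m = 1` the exponent `m - 1 - 1` is truncated, but its term carries the factor `m - 1 =
    -- 0`.
    rcases Nat.eq_zero_or_pos (m - 1) with h | h
    · rw [h]
      simp
    · obtain ⟨k, hk⟩ : ∃ k, m - 1 = k + 1 := ⟨m - 1 - 1, by omega⟩
      rw [hk]
      simp only [Nat.add_sub_cancel]
      ring

theorem isSmoothQSH_normSq {m : ℕ} (hm : 1 ≤ m) (hmn : m ≤ n) (Ω : Set (HSpace n)) :
    IsSmoothQSH m Ω fun y => ‖y - 0‖ ^ 2 := by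
  have h : ∀ t : ℝ, deriv (fun t : ℝ => t) t = 1 := fun t => deriv_id t
  have h' : deriv (deriv fun t : ℝ => t) = 0 := by
    rw [show (deriv fun t : ℝ => t) = fun _ => 1 from funext h]
    funext t
    simp
  refine isSmoothQSH_radial hm hmn Ω (f := fun t => t) contDiff_id 0 (fun t _ => ?_) fun t _ => ?_
  · rw [h]; norm_num
  · rw [h, h']
    simp only [Pi.zero_apply, mul_zero, add_zero, mul_one]
    positivity

/-- With every `v_j` equal to `‖y‖ ^ 2`, each `Δv_j` is `8 β_n`, so the mixed current is `8^{m-1}`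
times the trace current. Writing `y - 0` fits the radial formulas. -/
theorem IsQSH.traceCurrent_nonneg {m : ℕ} (hm : 1 ≤ m) (hmn : m ≤ n) {u : HSpace n → EReal}
    (hu : IsQSH m Ω u) {φ : HSpace n → ℝ} (hφ : IsTest Ω φ) (h0 : ∀ x, 0 ≤ φ x) :
    0 ≤ traceCurrent Ω u φ := by
  have h := hu.nonneg (fun _ y => ‖y - 0‖ ^ 2) (fun _ => isSmoothQSH_normSq hm hmn Ω) φ hφ h0
  have hb : ∀ x : HSpace n, baston (fun y : HSpace n => ‖y - 0‖ ^ 2) x = (8 : ℂ) • beta n := by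
    intro x
    have h1 : deriv (fun t : ℝ => t) = fun _ => 1 := funext fun t => deriv_id t
    rw [baston_radial (f := fun t => t) contDiff_id, h1]
    simp
  have he : hessianCurrent Ω u (fun (_ : Fin (m - 1)) y => ‖y - 0‖ ^ 2) (n - m) φ =
      8 ^ (m - 1) * traceCurrent Ω u φ := by
    rw [traceCurrent_eq, hessianCurrent, ← integral_const_mul]
    refine integral_congr_ae (Eventually.of_forall fun x => ?_)
    simp only [List.ofFn_const, List.prod_replicate, hb, smul_pow, smul_mul_assoc, map_smul,
      smul_eq_mul, ← pow_add, show m - 1 + (n - m) = n - 1 by omega]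
    ring
  rw [he] at h
  have h8 : (0 : ℂ) < 8 ^ (m - 1) := by positivity
  rw [← inv_mul_cancel_left₀ h8.ne' (traceCurrent Ω u φ)]
  exact mul_nonneg (by positivity) h

theorem exists_isTest_eq_one (hΩ : IsOpen Ω) {K : Set (HSpace n)} (hK : IsCompact K)
    (hKΩ : K ⊆ Ω) :
    ∃ χ : HSpace n → ℝ, IsTest Ω χ ∧ (∀ x, 0 ≤ χ x) ∧ (∀ x, χ x ≤ 1) ∧ ∀ x ∈ K, χ x = 1 := by
  obtain ⟨K', hK', hKK', hK'Ω⟩ := exists_compact_between hK hΩ hKΩ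
  obtain ⟨χ, hχ, hr, hs, h1⟩ := exists_contMDiff_support_eq_eq_one_iff (n := ⊤)
    (modelWithCornersSelf ℝ (HSpace n)) isOpen_interior hK.isClosed hKK'
  have hts : tsupport χ ⊆ K' :=
    closure_minimal (hs ▸ interior_subset) hK'.isClosed
  exact ⟨χ, ⟨contMDiff_iff_contDiff.1 hχ, hK'.of_isClosed_subset (isClosed_tsupport _) hts,
    hts.trans hK'Ω⟩, fun x => (hr ⟨x, rfl⟩).1, fun x => (hr ⟨x, rfl⟩).2, fun x hx => (h1 x).1 hx⟩

/-- With a cutoff `χ` equal to `1` on the support of `φ` and `C` bounding `|φ|`, both `χ` and `C χ +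
φ` are nonnegative tests. Their currents are real, hence so is that of `φ`. -/
theorem IsQSH.traceCurrent_im {m : ℕ} (hm : 1 ≤ m) (hmn : m ≤ n) (hΩ : IsOpen Ω)
    {u : HSpace n → EReal} (hu : IsQSH m Ω u) {φ : HSpace n → ℝ} (hφ : IsTest Ω φ) :
    (((traceCurrent Ω u φ).re : ℝ) : ℂ) = traceCurrent Ω u φ := by
  obtain ⟨χ, hχ, h0, -, h1⟩ := exists_isTest_eq_one hΩ hφ.2.1.isCompact hφ.2.2
  obtain ⟨C, hC⟩ := hφ.1.continuous.bounded_above_of_compact_support hφ.2.1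
  have hC0 : 0 ≤ C := (norm_nonneg _).trans (hC 0)
  have hpos : ∀ x, 0 ≤ C * χ x + φ x := by
    intro x
    by_cases hx : x ∈ tsupport φ
    · rw [h1 x hx]
      have := abs_le.1 ((Real.norm_eq_abs _) ▸ hC x)
      linarith [this.1]
    · rw [image_eq_zero_of_notMem_tsupport hx, add_zero]
      exact mul_nonneg hC0 (h0 x)
  have h2 := hu.traceCurrent_nonneg hm hmn (hχ.smul_add hφ C) hpos
  rw [traceCurrent_smul_add hΩ hu.locInt hχ hφ] at h2
  have h3 := hu.traceCurrent_nonneg hm hmn hχ h0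
  have h4 := (Complex.le_def.1 h2).2
  have h5 := (Complex.le_def.1 h3).2
  simp only [Complex.zero_im, Complex.add_im, Complex.mul_im, Complex.ofReal_re,
    Complex.ofReal_im, zero_mul, add_zero] at h4 h5
  rw [← h5, mul_zero, zero_add] at h4
  exact Complex.ext (by simp) (by simpa using h4)

end Current

open scoped CompactlySupported

/-! ### Positive functionals on test functions -/

section Riesz

variable {n : ℕ} {Ω : Set (HSpace n)}

/-- The extension by zero of a function on `Ω`. -/
noncomputable def extendZero (f : C_c(Ω, ℝ)) : HSpace n → ℝ :=
  Function.extend Subtype.val f 0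

theorem extendZero_apply (f : C_c(Ω, ℝ)) (x : Ω) : extendZero f x = f x :=
  Subtype.val_injective.extend_apply _ _ _

theorem extendZero_of_notMem (f : C_c(Ω, ℝ)) {x : HSpace n} (hx : x ∉ Ω) :
    extendZero f x = 0 :=
  Function.extend_apply' _ _ _ fun ⟨y, hy⟩ => hx (hy ▸ y.2)

theorem extendZero_smul_add (f g : C_c(Ω, ℝ)) (c : ℝ) :
    extendZero (c • f + g) = fun y => c * extendZero f y + extendZero g y := by
  funext x
  by_cases hx : x ∈ Ω
  · lift x to Ω using hx
    simp [extendZero_apply]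
  · simp [extendZero_of_notMem _ hx]

theorem extendZero_zero : extendZero (0 : C_c(Ω, ℝ)) = 0 := by
  funext x
  by_cases hx : x ∈ Ω
  · lift x to Ω using hx
    simp [extendZero_apply]
  · simp [extendZero_of_notMem _ hx]

theorem IsTest.exists_extendZero_eq {φ : HSpace n → ℝ} (hφ : IsTest Ω φ) :
    ∃ f : C_c(Ω, ℝ), extendZero f = φ := by
  have hK : IsCompact (Subtype.val ⁻¹' tsupport φ : Set Ω) :=
    Topology.IsInducing.subtypeVal.isCompact_preimage_iff (by simpa using hφ.2.2) |>.2
      hφ.2.1.isCompact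
  refine ⟨⟨⟨fun x => φ x, hφ.1.continuous.comp continuous_subtype_val⟩,
    HasCompactSupport.intro hK fun x hx =>
      image_eq_zero_of_notMem_tsupport (f := φ) hx⟩, ?_⟩
  funext x
  by_cases hx : x ∈ Ω
  · lift x to Ω using hx
    rw [extendZero_apply]
    rfl
  · rw [extendZero_of_notMem _ hx, image_eq_zero_of_notMem_tsupport fun h => hx (hφ.2.2 h)]

/-- The elements of `C_c(Ω)` whose extension by zero is a test function. -/
def testSubmodule (Ω : Set (HSpace n)) : Submodule ℝ C_c(Ω, ℝ) where
  carrier := {f | IsTest Ω (extendZero f)}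
  add_mem' {f g} hf hg := by
    have := IsTest.smul_add hf hg 1
    rw [← extendZero_smul_add, one_smul] at this
    exact this
  zero_mem' := by
    rw [Set.mem_ofPred_eq, extendZero_zero]
    exact isTest_zero
  smul_mem' c f hf := by
    have := IsTest.smul_add hf (isTest_zero (Ω := Ω)) c
    rw [← extendZero_zero, ← extendZero_smul_add, add_zero] at this
    exact this

/-- The representation theorem needs a positive functional on all of `C_c(Ω)`. The M. Riesz
extension theorem supplies one, because every `f` in `C_c(Ω)` becomes nonnegative after adding a
multiple of a cutoff. No density of test functions is needed. -/
theorem exists_measure_of_nonneg (hΩ : IsOpen Ω) (L : (HSpace n → ℝ) → ℝ)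
    (hadd : ∀ (c : ℝ) (φ ψ : HSpace n → ℝ), IsTest Ω φ → IsTest Ω ψ →
      L (fun y => c * φ y + ψ y) = c * L φ + L ψ)
    (hpos : ∀ φ : HSpace n → ℝ, IsTest Ω φ → (∀ x, 0 ≤ φ x) → 0 ≤ L φ) :
    ∃ μ : Measure (HSpace n), μ Ωᶜ = 0 ∧ (∀ K, IsCompact K → K ⊆ Ω → μ K < ⊤) ∧
      ∀ φ, IsTest Ω φ → ∫ x, φ x ∂μ = L φ := by
  have hL0 : L 0 = 0 := by
    have h := hadd 1 0 0 isTest_zero isTest_zero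
    have e : (fun y : HSpace n => 1 * (0 : HSpace n → ℝ) y + (0 : HSpace n → ℝ) y) = 0 := by
      funext y; simp
    rw [e] at h
    linarith
  let ℓ : testSubmodule Ω →ₗ[ℝ] ℝ :=
    { toFun := fun f => L (extendZero f.1)
      map_add' := fun f g => by
        have := hadd 1 _ _ f.2 g.2
        rw [← extendZero_smul_add, one_smul, one_mul] at this
        exact this
      map_smul' := fun c f => by
        have := hadd c _ _ f.2 (isTest_zero (Ω := Ω))
        rw [hL0, ← extendZero_zero (Ω := Ω), ← extendZero_smul_add, add_zero, add_zero] at this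
        exact this }
  let s : PointedCone ℝ C_c(Ω, ℝ) :=
    { carrier := {f | ∀ x, 0 ≤ f x}
      add_mem' := fun {f g} hf hg x => add_nonneg (hf x) (hg x)
      zero_mem' := fun x => le_rfl
      smul_mem' := fun c f hf x => mul_nonneg c.2 (hf x) }
  obtain ⟨g, hg, hgpos⟩ := riesz_extension s ⟨testSubmodule Ω, ℓ⟩
    (fun f hf => hpos _ f.2 fun x => by
      by_cases hx : x ∈ Ω
      · lift x to Ω using hx
        rw [extendZero_apply]
        exact hf x
      · rw [extendZero_of_notMem _ hx])
    (fun f => by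
      have hK : IsCompact (Subtype.val '' tsupport f) :=
        f.hasCompactSupport.isCompact.image continuous_subtype_val
      obtain ⟨χ, hχ, h0, -, h1⟩ := exists_isTest_eq_one hΩ hK (by simp)
      obtain ⟨C, hC⟩ := f.continuous.bounded_above_of_compact_support f.hasCompactSupport
      have hCχ : IsTest Ω fun y => C * χ y + (0 : HSpace n → ℝ) y := hχ.smul_add isTest_zero C
      obtain ⟨k, hk⟩ := hCχ.exists_extendZero_eq
      refine ⟨⟨k, ?_⟩, fun x => ?_⟩
      · change IsTest Ω (extendZero k)
        rw [hk]
        exact hCχ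
      · change 0 ≤ k x + f x
        rw [← extendZero_apply, hk]
        simp only [Pi.zero_apply, add_zero]
        by_cases hx : x ∈ tsupport f
        · rw [h1 _ ⟨x, hx, rfl⟩]
          have : -C ≤ f x ∧ f x ≤ C := abs_le.1 ((Real.norm_eq_abs _) ▸ hC x)
          linarith [this.1]
        · rw [image_eq_zero_of_notMem_tsupport hx, add_zero]
          exact mul_nonneg ((norm_nonneg _).trans (hC x)) (h0 x))
  have : LocallyCompactSpace Ω := hΩ.locallyCompactSpace
  let Λ : C_c(Ω, ℝ) →ₚ[ℝ] ℝ := PositiveLinearMap.mk₀ g fun f hf => hgpos f fun x => hf x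
  have hemb : MeasurableEmbedding (Subtype.val : Ω → HSpace n) :=
    MeasurableEmbedding.subtype_coe hΩ.measurableSet
  refine ⟨(RealRMK.rieszMeasure Λ).map Subtype.val, ?_, fun K hK hKΩ => ?_, fun φ hφ => ?_⟩
  · rw [hemb.map_apply]
    simp
  · rw [hemb.map_apply]
    exact (Topology.IsInducing.subtypeVal.isCompact_preimage_iff (by simpa using hKΩ) |>.2
      hK).measure_lt_top
  · obtain ⟨f, rfl⟩ := hφ.exists_extendZero_eq
    rw [hemb.integral_map]
    simp only [extendZero_apply]
    rw [RealRMK.integral_rieszMeasure]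
    exact hg ⟨f, hφ⟩

/-! ### Uniqueness of a measure with given integrals of test functions -/

theorem IsTest.integrable {μ : Measure (HSpace n)} (hμ : ∀ K, IsCompact K → K ⊆ Ω → μ K < ⊤)
    {φ : HSpace n → ℝ} (hφ : IsTest Ω φ) : Integrable φ μ := by
  have := isFiniteMeasure_restrict.2 (hμ _ hφ.2.1.isCompact hφ.2.2).ne
  obtain ⟨C, hC⟩ := hφ.1.continuous.bounded_above_of_compact_support hφ.2.1
  exact (integrableOn_iff_integrable_of_support_subset (subset_tsupport φ)).1
    (Integrable.of_bound hφ.1.continuous.aestronglyMeasurable C (Eventually.of_forall hC))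

theorem measure_compact_le_of_integral_test_eq (hΩ : IsOpen Ω) {μ ν : Measure (HSpace n)}
    (hμ : ∀ K, IsCompact K → K ⊆ Ω → μ K < ⊤) (hν : ∀ K, IsCompact K → K ⊆ Ω → ν K < ⊤)
    (h : ∀ φ, IsTest Ω φ → ∫ x, φ x ∂μ = ∫ x, φ x ∂ν) {K : Set (HSpace n)} (hK : IsCompact K)
    (hKΩ : K ⊆ Ω) : μ K ≤ ν K := by
  obtain ⟨K', hK', hKK', hK'Ω⟩ := exists_compact_between hK hΩ hKΩ
  have hfin : IsFiniteMeasure (ν.restrict K') := isFiniteMeasure_restrict.2 (hν _ hK' hK'Ω).ne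
  refine ENNReal.le_of_forall_pos_le_add fun ε hε _ => ?_
  -- Outer regularity is applied to `ν` restricted to the compact neighbourhood `K'`, since `ν` is
  -- only known to be finite on compact subsets of `Ω`. A cutoff supported in `U ∩ interior K'` then
  -- compares the two measures.
  have hε' : (ε : ENNReal) ≠ 0 := by exact_mod_cast hε.ne'
  obtain ⟨U, hKU, hU, hUlt⟩ := K.exists_isOpen_lt_add (measure_ne_top (ν.restrict K') K) hε'
  have hV : IsOpen (U ∩ interior K') := hU.inter isOpen_interior
  obtain ⟨χ, hχ, h0, hle, h1⟩ := exists_isTest_eq_one hV hK (Set.subset_inter hKU hKK')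
  have hχΩ : IsTest Ω χ := ⟨hχ.1, hχ.2.1, hχ.2.2.trans
    (Set.inter_subset_right.trans (interior_subset.trans hK'Ω))⟩
  have e1 : ENNReal.ofReal (∫ x, χ x ∂μ) = ∫⁻ x, ENNReal.ofReal (χ x) ∂μ :=
    ofReal_integral_eq_lintegral_ofReal (hχΩ.integrable hμ) (Eventually.of_forall h0)
  have e2 : ENNReal.ofReal (∫ x, χ x ∂ν) = ∫⁻ x, ENNReal.ofReal (χ x) ∂ν :=
    ofReal_integral_eq_lintegral_ofReal (hχΩ.integrable hν) (Eventually.of_forall h0)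
  calc μ K = ∫⁻ x, K.indicator 1 x ∂μ := (lintegral_indicator_one hK.measurableSet).symm
    _ ≤ ∫⁻ x, ENNReal.ofReal (χ x) ∂μ := by
        refine lintegral_mono fun x => ?_
        by_cases hx : x ∈ K
        · simp [hx, h1 x hx]
        · simp [hx]
    _ = ∫⁻ x, ENNReal.ofReal (χ x) ∂ν := by rw [← e1, ← e2, h χ hχΩ]
    _ ≤ ∫⁻ x, (U ∩ interior K').indicator 1 x ∂ν := by
        refine lintegral_mono fun x => ?_
        by_cases hx : x ∈ U ∩ interior K'
        · rw [Set.indicator_of_mem hx]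
          exact ENNReal.ofReal_le_one.2 (hle x)
        · rw [image_eq_zero_of_notMem_tsupport fun h' => hx (hχ.2.2 h')]
          simp
    _ = ν (U ∩ interior K') := lintegral_indicator_one hV.measurableSet
    _ ≤ (ν.restrict K') U := by
        rw [Measure.restrict_apply hU.measurableSet]
        exact measure_mono (Set.inter_subset_inter_right _ interior_subset)
    _ ≤ (ν.restrict K') K + ε := hUlt.le
    _ ≤ ν K + ε := add_le_add_left (Measure.restrict_apply_le _ _) _

/-- The space is covered by `Ωᶜ`, null for both measures, and countably many compact subsets of `Ω`.
On each of these the measures are finite and agree on the π-system of closed sets. -/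
theorem measure_eq_of_compact_eq (hΩ : IsOpen Ω) {μ ν : Measure (HSpace n)}
    (hμ0 : μ Ωᶜ = 0) (hν0 : ν Ωᶜ = 0) (hμ : ∀ K, IsCompact K → K ⊆ Ω → μ K < ⊤)
    (h : ∀ K, IsCompact K → K ⊆ Ω → μ K = ν K) : μ = ν := by
  obtain ⟨F, hFc, hFΩ, hFU, -⟩ := hΩ.exists_iUnion_isClosed
  let S : Option (ℕ × ℕ) → Set (HSpace n) := fun i =>
    i.elim Ωᶜ fun p => F p.1 ∩ Metric.closedBall 0 p.2
  refine (Measure.ext_iff_of_iUnion_eq_univ (s := S) ?_).2 fun i => ?_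
  · refine Set.eq_univ_of_forall fun x => ?_
    by_cases hx : x ∈ Ω
    · rw [← hFU] at hx
      obtain ⟨j, hj⟩ := Set.mem_iUnion.1 hx
      obtain ⟨k, hk⟩ := exists_nat_ge ‖x‖
      exact Set.mem_iUnion.2 ⟨some (j, k), hj, by simpa using hk⟩
    · exact Set.mem_iUnion.2 ⟨none, hx⟩
  · cases i with
    | none =>
      change μ.restrict Ωᶜ = ν.restrict Ωᶜ
      rw [Measure.restrict_eq_zero.2 hμ0, Measure.restrict_eq_zero.2 hν0]
    | some p =>
      change μ.restrict (F p.1 ∩ Metric.closedBall 0 p.2) =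
        ν.restrict (F p.1 ∩ Metric.closedBall 0 p.2)
      have hK : IsCompact (F p.1 ∩ Metric.closedBall 0 (p.2 : ℝ)) :=
        (isCompact_closedBall _ _).inter_left (hFc _)
      have hKΩ : F p.1 ∩ Metric.closedBall 0 (p.2 : ℝ) ⊆ Ω := Set.inter_subset_left.trans (hFΩ _)
      have : IsFiniteMeasure (μ.restrict (F p.1 ∩ Metric.closedBall 0 (p.2 : ℝ))) :=
        isFiniteMeasure_restrict.2 (hμ _ hK hKΩ).ne
      refine ext_of_generate_finite {s | IsClosed s} (BorelSpace.measurable_eq.trans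
        (borel_eq_generateFrom_isClosed)) isPiSystem_isClosed (fun s hs => ?_) ?_
      · have hs' : IsClosed s := hs
        rw [Measure.restrict_apply hs'.measurableSet, Measure.restrict_apply hs'.measurableSet]
        exact h _ (hK.inter_left hs') (Set.inter_subset_right.trans hKΩ)
      · rw [Measure.restrict_apply_univ, Measure.restrict_apply_univ]
        exact h _ hK hKΩ

theorem IsQSH.existsUnique_isTraceMeasure {m : ℕ} (hm : 1 ≤ m) (hmn : m ≤ n) (hΩ : IsOpen Ω)
    {u : HSpace n → EReal} (hu : IsQSH m Ω u) :
    ∃! μ : Measure (HSpace n), IsTraceMeasure Ω u μ := by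
  obtain ⟨μ, h0, hK, hint⟩ := exists_measure_of_nonneg hΩ (fun φ => (traceCurrent Ω u φ).re)
    (fun c φ ψ hφ hψ => by
      rw [traceCurrent_smul_add hΩ hu.locInt hφ hψ]
      simp)
    (fun φ hφ h => (Complex.le_def.1 (hu.traceCurrent_nonneg hm hmn hφ h)).1)
  refine ⟨μ, ⟨h0, hK, fun φ hφ => ?_⟩, fun ν hν => ?_⟩
  · rw [hint φ hφ]
    exact hu.traceCurrent_im hm hmn hΩ hφ
  · have h : ∀ φ, IsTest Ω φ → ∫ x, φ x ∂ν = ∫ x, φ x ∂μ := by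
      intro φ hφ
      rw [hint φ hφ]
      exact congrArg Complex.re (hν.integral_eq φ hφ)
    refine measure_eq_of_compact_eq hΩ hν.compl_eq_zero h0 hν.finite_on_compacts
      fun K hKc hKΩ => le_antisymm ?_ ?_
    · exact measure_compact_le_of_integral_test_eq hΩ hν.finite_on_compacts hK h hKc hKΩ
    · exact measure_compact_le_of_integral_test_eq hΩ hK hν.finite_on_compacts
        (fun φ hφ => (h φ hφ).symm) hKc hKΩ

end Riesz

/-! ### Auxiliary functions of one variable -/

theorem exists_contDiff_primitive {w : ℝ → ℝ} (hw : ContDiff ℝ ∞ w) (b : ℝ) :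
    ContDiff ℝ ∞ (fun t => ∫ s in b..t, w s) ∧ deriv (fun t => ∫ s in b..t, w s) = w := by
  have hd : deriv (fun t => ∫ s in b..t, w s) = w :=
    funext fun t => hw.continuous.deriv_integral w b t
  refine ⟨contDiff_infty_iff_deriv.2 ⟨fun t => ?_, by rwa [hd]⟩, hd⟩
  exact (hw.continuous.integral_hasStrictDerivAt b t).hasDerivAt.differentiableAt

/-- The smooth step from `0` on `(-∞, b - δ]` to `1` on `[b, ∞)`. -/
noncomputable def smoothStep (b δ t : ℝ) : ℝ := Real.smoothTransition ((t - (b - δ)) / δ)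

section SmoothStep

variable {b δ : ℝ}

theorem contDiff_smoothStep (b δ : ℝ) : ContDiff ℝ ∞ (smoothStep b δ) :=
  (Real.smoothTransition.contDiff (n := ⊤)).comp ((contDiff_id.sub contDiff_const).div_const δ)

theorem monotone_smoothStep (hδ : 0 < δ) : Monotone (smoothStep b δ) := fun s t h =>
  Real.smoothTransition.monotone (by gcongr)

theorem smoothStep_nonneg (t : ℝ) : 0 ≤ smoothStep b δ t := Real.smoothTransition.nonneg _

theorem smoothStep_le_one (t : ℝ) : smoothStep b δ t ≤ 1 := Real.smoothTransition.le_one _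

theorem smoothStep_of_le (hδ : 0 < δ) {t : ℝ} (ht : t ≤ b - δ) : smoothStep b δ t = 0 :=
  Real.smoothTransition.zero_of_nonpos (div_nonpos_of_nonpos_of_nonneg (by linarith) hδ.le)

theorem smoothStep_of_ge (hδ : 0 < δ) {t : ℝ} (ht : b ≤ t) : smoothStep b δ t = 1 :=
  Real.smoothTransition.one_of_one_le ((one_le_div hδ).2 (by linarith))

theorem contDiff_deriv_smoothStep (b δ : ℝ) : ContDiff ℝ ∞ (deriv (smoothStep b δ)) :=
  (contDiff_infty_iff_deriv.1 (contDiff_smoothStep b δ)).2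

theorem hasDerivAt_smoothStep (b δ t : ℝ) :
    HasDerivAt (smoothStep b δ) (deriv (smoothStep b δ) t) t :=
  ((contDiff_smoothStep b δ).differentiable (by simp) t).hasDerivAt

theorem deriv_smoothStep_nonneg (hδ : 0 < δ) (t : ℝ) : 0 ≤ deriv (smoothStep b δ) t :=
  (monotone_smoothStep hδ).deriv_nonneg

theorem deriv_smoothStep_of_lt (hδ : 0 < δ) {t : ℝ} (ht : t < b - δ) :
    deriv (smoothStep b δ) t = 0 := by
  have h : smoothStep b δ =ᶠ[𝓝 t] fun _ => 0 := by
    filter_upwards [Iio_mem_nhds ht] with s hs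
    exact smoothStep_of_le hδ (le_of_lt hs)
  rw [h.deriv_eq, deriv_const]

theorem deriv_smoothStep_of_gt (hδ : 0 < δ) {t : ℝ} (ht : b < t) :
    deriv (smoothStep b δ) t = 0 := by
  have h : smoothStep b δ =ᶠ[𝓝 t] fun _ => 1 := by
    filter_upwards [Ioi_mem_nhds ht] with s hs
    exact smoothStep_of_ge hδ (le_of_lt hs)
  rw [h.deriv_eq, deriv_const]

theorem integral_deriv_smoothStep (hδ : 0 < δ) (t : ℝ) :
    ∫ s in t..b, deriv (smoothStep b δ) s = 1 - smoothStep b δ t := by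
  rw [intervalIntegral.integral_eq_sub_of_hasDerivAt (fun s _ => hasDerivAt_smoothStep b δ s)
    ((contDiff_deriv_smoothStep b δ).continuous.intervalIntegrable _ _),
    smoothStep_of_ge hδ le_rfl]

/-- A smooth decreasing function with derivative `-F T'`, for `T` the smooth step on `[b - δ, b]`
and `F` a positive function that decreases on this interval. -/
theorem exists_weighted_step (hδ : 0 < δ) {F : ℝ → ℝ} (hF : ContDiff ℝ ∞ F)
    (hb : 0 ≤ F b) (hlow : ∀ s ∈ Set.Icc (b - δ) b, F b ≤ F s)
    (hupp : ∀ s ∈ Set.Icc (b - δ) b, F s ≤ F (b - δ)) :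
    ∃ H : ℝ → ℝ, ContDiff ℝ ∞ H ∧ deriv H = (fun t => -(F t * deriv (smoothStep b δ) t)) ∧
      (∀ t, b ≤ t → H t = 0) ∧ (∀ t, 0 ≤ H t) ∧ (∀ t, H t ≤ F (b - δ)) ∧
      ∀ t ≤ b - δ, F b ≤ H t := by
  have hw : ContDiff ℝ ∞ fun t => -(F t * deriv (smoothStep b δ) t) :=
    (hF.mul (contDiff_deriv_smoothStep b δ)).neg
  obtain ⟨h1, h2⟩ := exists_contDiff_primitive hw b
  set H : ℝ → ℝ := fun t => ∫ s in b..t, -(F s * deriv (smoothStep b δ) s) with hH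
  have hH' : ∀ t, H t = ∫ s in t..b, F s * deriv (smoothStep b δ) s := by
    intro t
    simp only [hH]
    rw [intervalIntegral.integral_neg, intervalIntegral.integral_symm t b, neg_neg]
  have hint : ∀ {f : ℝ → ℝ}, Continuous f → ∀ t,
      IntervalIntegrable (fun s => f s * deriv (smoothStep b δ) s) volume t b := fun hf t =>
    (hf.mul (contDiff_deriv_smoothStep b δ).continuous).intervalIntegrable _ _
  have hz : ∀ t, b ≤ t → H t = 0 := by
    intro t ht
    rw [hH', intervalIntegral.integral_symm, neg_eq_zero]
    refine intervalIntegral.integral_zero_ae (Eventually.of_forall fun s hs => ?_)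
    rw [Set.uIoc_of_le ht] at hs
    rw [deriv_smoothStep_of_gt hδ hs.1, mul_zero]
  -- On `t ≤ b`, `H t` is the integral of `F T'` over `[t, b]`. There `T'` lives on `[b - δ, b]`,
  -- where `F b ≤ F ≤ F (b - δ)`, and the integral of `T'` is `1 - T t`.
  have hlow' : ∀ t ≤ b, F b * (1 - smoothStep b δ t) ≤ H t := by
    intro t ht
    rw [hH', ← integral_deriv_smoothStep hδ, ← intervalIntegral.integral_const_mul]
    refine intervalIntegral.integral_mono_on ht (hint continuous_const t)
      (hint hF.continuous t) fun s hs => ?_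
    by_cases hs' : s < b - δ
    · simp [deriv_smoothStep_of_lt hδ hs']
    · exact mul_le_mul_of_nonneg_right (hlow s ⟨not_lt.1 hs', hs.2⟩)
        (deriv_smoothStep_nonneg hδ s)
  have hupp' : ∀ t ≤ b, H t ≤ F (b - δ) * (1 - smoothStep b δ t) := by
    intro t ht
    rw [hH', ← integral_deriv_smoothStep hδ, ← intervalIntegral.integral_const_mul]
    refine intervalIntegral.integral_mono_on ht (hint hF.continuous t)
      (hint continuous_const t) fun s hs => ?_
    by_cases hs' : s < b - δ
    · simp [deriv_smoothStep_of_lt hδ hs']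
    · exact mul_le_mul_of_nonneg_right (hupp s ⟨not_lt.1 hs', hs.2⟩)
        (deriv_smoothStep_nonneg hδ s)
  have hF0 : 0 ≤ F (b - δ) := hb.trans (hlow _ ⟨le_rfl, by linarith⟩)
  refine ⟨H, h1, h2, hz, fun t => ?_, fun t => ?_, fun t ht => ?_⟩
  · rcases le_total b t with h | h
    · exact (hz t h).ge
    · exact (mul_nonneg hb (sub_nonneg.2 (smoothStep_le_one t))).trans (hlow' t h)
  · rcases le_total b t with h | h
    · rw [hz t h]; exact hF0
    · refine (hupp' t h).trans (mul_le_of_le_one_right hF0 ?_)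
      linarith [smoothStep_nonneg (b := b) (δ := δ) t]
  · have := hlow' t (by linarith)
    rwa [smoothStep_of_le hδ ht, sub_zero, mul_one] at this

end SmoothStep

/-- A smooth function with derivative `t^{-s}` for `t ≥ c`, and such that `t^s f'` increases. -/
theorem exists_regularized_power {c : ℝ} (hc : 0 < c) (s : ℝ) :
    ∃ f : ℝ → ℝ, ContDiff ℝ ∞ f ∧ (∀ t, 0 ≤ t → 0 ≤ deriv f t) ∧
      (∀ t, 0 ≤ t → 0 ≤ s * deriv f t + t * deriv (deriv f) t) ∧
      ∀ t, c ≤ t → deriv f t = t ^ (-s) := by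
  have hc2 : 0 < c / 2 := by positivity
  set T := smoothStep c (c / 2) with hT
  -- The step `T` vanishes for `t ≤ c / 2`, which removes the singularity at `0`, and `t^s w = T` is
  -- nondecreasing for `t > 0`.
  set w : ℝ → ℝ := fun t => t ^ (-s) * T t with hwdef
  have hT0 : ∀ t ≤ c / 2, T t = 0 := fun t ht => smoothStep_of_le hc2 (by linarith)
  have hw : ContDiff ℝ ∞ w := by
    rw [contDiff_iff_contDiffAt]
    intro t
    rcases lt_or_ge t (c / 2) with h | h
    · have : w =ᶠ[𝓝 t] fun _ => 0 := by
        filter_upwards [Iio_mem_nhds h] with x hx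
        simp [hwdef, hT0 x (le_of_lt hx)]
      exact contDiffAt_const.congr_of_eventuallyEq this
    · exact (Real.contDiffAt_rpow_const_of_ne (by linarith)).mul
        (contDiff_smoothStep _ _).contDiffAt
  obtain ⟨h1, h2⟩ := exists_contDiff_primitive hw 0
  refine ⟨_, h1, fun t ht => ?_, fun t ht => ?_, fun t ht => ?_⟩
  · rw [h2]
    exact mul_nonneg (Real.rpow_nonneg ht _) (smoothStep_nonneg t)
  · rw [h2]
    rcases ht.eq_or_lt with rfl | ht
    · simp [hwdef, hT0 0 hc2.le]
    · have hd : HasDerivAt w (-s * t ^ (-s - 1) * T t + t ^ (-s) * deriv T t) t :=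
        (Real.hasDerivAt_rpow_const (Or.inl ht.ne')).mul (hasDerivAt_smoothStep _ _ t)
      rw [hd.deriv]
      have e : t * t ^ (-s - 1) = t ^ (-s) := by
        rw [mul_comm, Real.rpow_sub_one ht.ne', div_mul_cancel₀ _ ht.ne']
      have : s * w t + t * (-s * t ^ (-s - 1) * T t + t ^ (-s) * deriv T t) =
          t * (t ^ (-s) * deriv T t) := by
        simp only [hwdef]
        linear_combination (-s * T t) * e
      rw [this]
      exact mul_nonneg ht.le (mul_nonneg (Real.rpow_nonneg ht.le _)
        (deriv_smoothStep_nonneg hc2 t))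
  · rw [h2]
    simp only [hwdef, hT, smoothStep_of_ge hc2 ht, mul_one]

/-! ### Monotonicity -/

section Lelong

variable {n m : ℕ} {Ω : Set (HSpace n)} {u : HSpace n → EReal}

theorem mem_ball_sqrt {a x : HSpace n} {t : ℝ} :
    x ∈ Metric.ball a (Real.sqrt t) ↔ ‖x - a‖ ^ 2 < t := by
  rw [mem_ball_iff_norm, Real.lt_sqrt (norm_nonneg _)]

theorem isTest_radial {a : HSpace n} {R t : ℝ} (hB : Metric.closedBall a R ⊆ Ω) (hR : 0 ≤ R)
    (ht : t ≤ R ^ 2) {G : ℝ → ℝ} (hG : ContDiff ℝ ∞ G) (hG0 : ∀ s, t ≤ s → G s = 0) :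
    IsTest Ω fun x => G (‖x - a‖ ^ 2) := by
  have hsub : tsupport (fun x : HSpace n => G (‖x - a‖ ^ 2)) ⊆ Metric.closedBall a R := by
    refine closure_minimal (fun x hx => ?_) Metric.isClosed_closedBall
    by_contra h
    rw [mem_closedBall_iff_norm, not_le] at h
    exact hx (hG0 _ (ht.trans (by gcongr)))
  exact ⟨hG.comp ((contDiff_id.sub contDiff_const).norm_sq ℝ),
    (isCompact_closedBall a R).of_isClosed_subset (isClosed_tsupport _) hsub, hsub.trans hB⟩

/-- The function `G` built below is at most `F(t₂ - δ)` on the ball of squared radius `t₂`, at most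
`F(t₂ - δ) - F(t₁)` on the ball of squared radius `t₁ - δ`, and zero outside the larger ball.
Integrating against `μ` and using `∫ G dμ ≥ 0` gives the inequality; `δ` is the width of the
smoothing. -/
theorem IsQSH.measure_ball_le (hm : 1 ≤ m) (hmn : m ≤ n) (hu : IsQSH m Ω u)
    {μ : Measure (HSpace n)} (hμ : IsTraceMeasure Ω u μ) {a : HSpace n} {R t₁ t₂ δ : ℝ}
    (hR : 0 ≤ R) (hB : Metric.closedBall a R ⊆ Ω) (hδ : 0 < δ) (h1 : δ < t₁) (h12 : t₁ < t₂)
    (h2 : t₂ ≤ R ^ 2) :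
    (t₁ ^ (-(2 * n / m : ℝ))) ^ (m - 1) * μ.real (Metric.ball a (Real.sqrt (t₁ - δ))) ≤
      ((t₂ - δ) ^ (-(2 * n / m : ℝ))) ^ (m - 1) * μ.real (Metric.ball a (Real.sqrt t₂)) := by
  set s : ℝ := 2 * n / m with hs
  have hs0 : 0 ≤ s := by positivity
  have hc : 0 < t₁ - δ := by linarith
  -- The cutoff level `t₁ - δ` makes `f'` an exact power wherever the derivative of either step is
  -- nonzero.
  obtain ⟨f, hf, hf0, hfs, hfc⟩ := exists_regularized_power hc s
  set F : ℝ → ℝ := fun t => deriv f t ^ (m - 1) with hFdef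
  have hF : ContDiff ℝ ∞ F := (contDiff_infty_iff_deriv.1 hf).2.pow _
  have hFanti : ∀ x y, t₁ - δ ≤ x → x ≤ y → F y ≤ F x := by
    intro x y hx hxy
    simp only [hFdef, hfc x hx, hfc y (hx.trans hxy)]
    have hx0 : 0 < x := hc.trans_le hx
    exact pow_le_pow_left₀ (Real.rpow_nonneg (hx0.le.trans hxy) _)
      (Real.rpow_le_rpow_of_nonpos hx0 hxy (by linarith)) _
  have hF0 : ∀ x, 0 ≤ x → 0 ≤ F x := fun x hx => pow_nonneg (hf0 x hx) _
  obtain ⟨H₁, hH₁, hd₁, hz₁, hp₁, -, hl₁⟩ := exists_weighted_step (b := t₁) hδ hF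
    (hF0 _ (by linarith)) (fun x hx => hFanti _ _ hx.1 hx.2) (fun x hx => hFanti _ _ le_rfl hx.1)
  obtain ⟨H₂, hH₂, hd₂, hz₂, hp₂, hu₂, -⟩ := exists_weighted_step (b := t₂) hδ hF
    (hF0 _ (by linarith)) (fun x hx => hFanti _ _ (by linarith [hx.1]) hx.2)
    (fun x hx => hFanti _ _ (by linarith) hx.1)
  -- A smoothed indicator of `(t₁, t₂)`: its derivative is `T₁' - T₂'`, so `F g'` is the derivative
  -- of `H₂ - H₁`.
  set g : ℝ → ℝ := fun t => smoothStep t₁ δ t - smoothStep t₂ δ t with hgdef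
  have hg : ContDiff ℝ ∞ g := (contDiff_smoothStep _ _).sub (contDiff_smoothStep _ _)
  have hg0 : ∀ t, 0 ≤ g t := fun t => sub_nonneg.2 <| Real.smoothTransition.monotone (by gcongr)
  have hgz : ∀ t, t₂ ≤ t → g t = 0 := fun t ht => by
    simp only [hgdef, smoothStep_of_ge hδ ht, smoothStep_of_ge hδ (h12.le.trans ht), sub_self]
  set G : ℝ → ℝ := fun t => H₂ t - H₁ t with hGdef
  have hG : ContDiff ℝ ∞ G := hH₂.sub hH₁
  have hGz : ∀ t, t₂ ≤ t → G t = 0 := fun t ht => by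
    simp only [hGdef, hz₂ t ht, hz₁ t (h12.le.trans ht), sub_self]
  have hfg : deriv G = fun t => deriv f t ^ (m - 1) * deriv g t := by
    funext t
    have e1 : deriv G t = deriv H₂ t - deriv H₁ t :=
      deriv_sub (hH₂.differentiable (by simp) t) (hH₁.differentiable (by simp) t)
    have e2 : deriv g t = deriv (smoothStep t₁ δ) t - deriv (smoothStep t₂ δ) t :=
      ((hasDerivAt_smoothStep _ _ t).sub (hasDerivAt_smoothStep _ _ t)).deriv
    rw [e1, e2, hd₁, hd₂]
    simp only [hFdef]
    ring
  have hGtest : IsTest Ω fun x => G (‖x - a‖ ^ 2) := isTest_radial hB hR h2 hG hGz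
  have hpos := hu.nonneg (fun _ y => f (‖y - a‖ ^ 2))
    (fun _ => isSmoothQSH_radial hm hmn Ω hf a hf0 hfs) (fun x => g (‖x - a‖ ^ 2))
    (isTest_radial hB hR h2 hg hgz) fun x => hg0 _
  rw [hessianCurrent_radial u hm hmn hf hg hG hfg, traceCurrent, ← hμ.integral_eq _ hGtest] at hpos
  have hpos' : 0 ≤ ∫ x, G (‖x - a‖ ^ 2) ∂μ := by
    have h8 : (0 : ℝ) < 8 ^ (m - 1) := by positivity
    refine nonneg_of_mul_nonneg_right ?_ h8
    exact_mod_cast hpos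
  have hfin : ∀ t, t ≤ R ^ 2 → μ (Metric.ball a (Real.sqrt t)) ≠ ⊤ := fun t ht =>
    ((measure_mono (Metric.ball_subset_closedBall.trans
      (Metric.closedBall_subset_closedBall (Real.sqrt_le_iff.2 ⟨hR, ht⟩)))).trans_lt
      (hμ.finite_on_compacts _ (isCompact_closedBall a R) hB)).ne
  have hi : ∀ (t : ℝ), t ≤ R ^ 2 → ∀ C : ℝ,
      Integrable ((Metric.ball a (Real.sqrt t)).indicator fun _ => C) μ := fun t ht C =>
    (integrable_indicator_iff Metric.isOpen_ball.measurableSet).2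
      (integrableOn_const (hfin t ht))
  have hle : ∫ x, G (‖x - a‖ ^ 2) ∂μ ≤
      ∫ x, ((Metric.ball a (Real.sqrt t₂)).indicator (fun _ => F (t₂ - δ)) x -
        (Metric.ball a (Real.sqrt (t₁ - δ))).indicator (fun _ => F t₁) x) ∂μ := by
    refine integral_mono (hGtest.integrable hμ.finite_on_compacts)
      ((hi _ h2 _).sub (hi _ (by linarith) _)) fun x => ?_
    rcases lt_or_ge (‖x - a‖ ^ 2) t₂ with hx | hx
    · rw [Set.indicator_of_mem (mem_ball_sqrt.2 hx)]
      rcases lt_or_ge (‖x - a‖ ^ 2) (t₁ - δ) with hx' | hx'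
      · rw [Set.indicator_of_mem (mem_ball_sqrt.2 hx')]
        exact sub_le_sub (hu₂ _) (hl₁ _ hx'.le)
      · rw [Set.indicator_of_notMem (mem_ball_sqrt.not.2 hx'.not_gt)]
        exact sub_le_sub (hu₂ _) (hp₁ _)
    · rw [Set.indicator_of_notMem (mem_ball_sqrt.not.2 hx.not_gt),
        Set.indicator_of_notMem (mem_ball_sqrt.not.2 (by linarith)), hGz _ hx, sub_zero]
  rw [integral_sub (hi _ h2 _) (hi _ (by linarith) _),
    integral_indicator_const _ Metric.isOpen_ball.measurableSet,
    integral_indicator_const _ Metric.isOpen_ball.measurableSet, smul_eq_mul, smul_eq_mul] at hle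
  have e1 : F t₁ = (t₁ ^ (-s)) ^ (m - 1) := by simp only [hFdef, hfc t₁ (by linarith)]
  have e2 : F (t₂ - δ) = ((t₂ - δ) ^ (-s)) ^ (m - 1) := by
    simp only [hFdef, hfc (t₂ - δ) (by linarith)]
  rw [← e1, ← e2]
  linarith

theorem tendsto_measure_ball_of_strictMono {μ : Measure (HSpace n)} {a : HSpace n} {r : ℝ}
    (hfin : μ (Metric.ball a r) ≠ ⊤) {ρ : ℕ → ℝ} (hρ : StrictMono ρ) (hlt : ∀ j, ρ j < r)
    (hlim : Tendsto ρ atTop (𝓝 r)) :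
    Tendsto (fun j => μ.real (Metric.ball a (ρ j))) atTop (𝓝 (μ.real (Metric.ball a r))) := by
  have hU : ⋃ j, Metric.ball a (ρ j) = Metric.ball a r := by
    refine Set.Subset.antisymm
      (Set.iUnion_subset fun j => Metric.ball_subset_ball (hlt j).le) fun x hx => ?_
    obtain ⟨j, hj⟩ := (hlim.eventually (Ioi_mem_nhds (Metric.mem_ball.1 hx))).exists
    exact Set.mem_iUnion.2 ⟨j, hj⟩
  have h := tendsto_measure_iUnion_atTop (μ := μ) (s := fun j => Metric.ball a (ρ j))
    fun i j hij => Metric.ball_subset_ball (hρ.monotone hij)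
  rw [hU] at h
  exact (ENNReal.tendsto_toReal hfin).comp h

theorem IsQSH.monotoneOn_measure_ball_div (hm : 1 ≤ m) (hmn : m ≤ n) (hu : IsQSH m Ω u)
    {μ : Measure (HSpace n)} (hμ : IsTraceMeasure Ω u μ) {a : HSpace n} {R : ℝ}
    (hB : Metric.closedBall a R ⊆ Ω) :
    MonotoneOn (fun r : ℝ => μ.real (Metric.ball a r) /
      r ^ (4 * (n : ℝ) * ((m : ℝ) - 1) / (m : ℝ))) (Set.Ioo 0 R) := by
  intro r₁ hr₁ r₂ hr₂ hr
  rcases hr.eq_or_lt with rfl | hr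
  · exact le_rfl
  have h01 : 0 < r₁ := hr₁.1
  have h02 : 0 < r₂ := hr₂.1
  have hR : 0 < R := h02.trans hr₂.2
  have hfin : μ (Metric.ball a r₁) ≠ ⊤ :=
    ((measure_mono (Metric.ball_subset_closedBall.trans
      (Metric.closedBall_subset_closedBall hr₁.2.le))).trans_lt
      (hμ.finite_on_compacts _ (isCompact_closedBall a R) hB)).ne
  -- Smoothing widths `δ = r₁² - ρ_j²` turn the inner ball into the ball of radius `ρ_j`. These
  -- balls increase to the open ball of radius `r₁`, so continuity of `μ` from below suffices.
  obtain ⟨ρ, hρ, hmem, hlim⟩ := exists_seq_strictMono_tendsto' h01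
  have hle : ∀ j, (((r₁ ^ 2) ^ (-(2 * n / m : ℝ))) ^ (m - 1)) * μ.real (Metric.ball a (ρ j)) ≤
      ((r₂ ^ 2 - (r₁ ^ 2 - ρ j ^ 2)) ^ (-(2 * n / m : ℝ))) ^ (m - 1) *
        μ.real (Metric.ball a r₂) := by
    intro j
    obtain ⟨h0, hj⟩ := hmem j
    have hsq : ρ j ^ 2 < r₁ ^ 2 := by gcongr
    have hpos : 0 < ρ j ^ 2 := by positivity
    have := hu.measure_ball_le hm hmn hμ (δ := r₁ ^ 2 - ρ j ^ 2) hR.le hB (sub_pos.2 hsq)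
      (by linarith) (show r₁ ^ 2 < r₂ ^ 2 by gcongr) (pow_le_pow_left₀ h02.le hr₂.2.le 2)
    rwa [sub_sub_cancel, Real.sqrt_sq h0.le, Real.sqrt_sq h02.le] at this
  have hl1 := (tendsto_measure_ball_of_strictMono hfin hρ (fun j => (hmem j).2) hlim).const_mul
    (((r₁ ^ 2) ^ (-(2 * n / m : ℝ))) ^ (m - 1))
  have hl2 : Tendsto (fun j => ((r₂ ^ 2 - (r₁ ^ 2 - ρ j ^ 2)) ^ (-(2 * n / m : ℝ))) ^ (m - 1) *
      μ.real (Metric.ball a r₂)) atTop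
      (𝓝 (((r₂ ^ 2) ^ (-(2 * n / m : ℝ))) ^ (m - 1) * μ.real (Metric.ball a r₂))) := by
    have h1 : Tendsto (fun j => r₂ ^ 2 - (r₁ ^ 2 - ρ j ^ 2)) atTop (𝓝 (r₂ ^ 2)) := by
      have := ((hlim.pow 2).const_sub (r₁ ^ 2)).const_sub (r₂ ^ 2)
      rwa [sub_self, sub_zero] at this
    exact ((h1.rpow_const (Or.inl (by positivity))).pow _).mul_const _
  have hfinal := le_of_tendsto_of_tendsto' hl1 hl2 hle
  have hexp : ∀ r : ℝ, 0 < r → ((r ^ 2) ^ (-(2 * n / m : ℝ))) ^ (m - 1) =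
      (r ^ (4 * (n : ℝ) * ((m : ℝ) - 1) / (m : ℝ)))⁻¹ := by
    intro r hr
    rw [← Real.rpow_natCast r 2, ← Real.rpow_mul hr.le, ← Real.rpow_natCast _ (m - 1),
      ← Real.rpow_mul hr.le, ← Real.rpow_neg hr.le]
    congr 1
    push_cast [Nat.cast_sub hm]
    ring
  rw [hexp r₁ h01, hexp r₂ h02] at hfinal
  simpa only [div_eq_inv_mul] using hfinal

end Lelong

end QuatHessian

theorem mainTheorem6 (n m : ℕ) (hm : 1 ≤ m) (hmn : m ≤ n)
    (Ω : Set (QuatHessian.HSpace n)) (hΩ : IsOpen Ω) (hΩc : IsConnected Ω)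
    (a : QuatHessian.HSpace n) (R : ℝ) (hR : 0 < R) (hB : closure (Metric.ball a R) ⊆ Ω)
    (u : QuatHessian.HSpace n → EReal) (hu : QuatHessian.IsQSH m Ω u) :
    (∃! μ : Measure (QuatHessian.HSpace n), QuatHessian.IsTraceMeasure Ω u μ) ∧
    ∀ μ : Measure (QuatHessian.HSpace n), QuatHessian.IsTraceMeasure Ω u μ →
      MonotoneOn (fun r : ℝ => μ.real (Metric.ball a r) /
        r ^ (4 * (n : ℝ) * ((m : ℝ) - 1) / (m : ℝ))) (Set.Ioo 0 R) ∧
      ∃ ν : ℝ, 0 ≤ ν ∧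
        Tendsto (fun r : ℝ => μ.real (Metric.ball a r) /
          r ^ (4 * (n : ℝ) * ((m : ℝ) - 1) / (m : ℝ))) (𝓝[>] 0) (𝓝 ν) := by
  refine ⟨hu.existsUnique_isTraceMeasure hm hmn hΩ, fun μ hμ => ?_⟩
  rw [closure_ball a hR.ne'] at hB
  have hmono := hu.monotoneOn_measure_ball_div hm hmn hμ hB
  have hnonneg : ∀ y ∈ (fun r : ℝ => μ.real (Metric.ball a r) /
      r ^ (4 * (n : ℝ) * ((m : ℝ) - 1) / (m : ℝ))) '' Set.Ioo 0 R, 0 ≤ y := by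
    rintro _ ⟨r, hr, rfl⟩
    exact div_nonneg measureReal_nonneg (Real.rpow_nonneg hr.1.le _)
  -- Being monotone and bounded below by `0`, the ratio tends at the left endpoint to its infimum
  -- over `(0, R)`.
  exact ⟨hmono, _, Real.sInf_nonneg hnonneg,
    hmono.tendsto_nhdsWithin_Ioo_right (Set.nonempty_Ioo.2 hR) ⟨0, hnonneg⟩⟩
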